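/- Let $V$ be a $2$-dimensional real vector space (the dual $V=W^*$ of a plane $W$) and let $S^3V\subset V^{\otimes 3}$ be the ($4$-dimensional) space of symmetric tensors. For a line $L\in\mathbb P(V)$ put $\psi(L)=L^{\otimes 3}\in\mathbb P(S^3V)$; in suitable coordinates $\psi$ is the rational normal curve $[x:y]\mapsto[x^3:x^2y:xy^2:y^3]$. A *Veronese $3$-polytope* is a $3$-dimensional polytope $P\subset S^3V$ of the form $P=C\cap H$, where $H$ is an affine hyperplane and $C\subset S^3V$ is a full-dimensional convex polyhedral cone containing no line such that each extremal ray of $C$ spans a line $\psi(L)$ for some $L\in\mathbb P(V)$. (Equivalently, up to linear isomorphism, $P$ is the $3$-dimensional convex hull of finitely many points $\frac{(x^3,x^2y,xy^2,y^3)}{\xi_0x^3+\xi_1x^2y+\xi_2xy^2+\xi_3y^3}$ with $(x,y)\in\mathbb R^2$ and non-vanishing denominators, for a fixed $\xi\in\mathbb R^4$.) Two polytopes are *combinatorially equivalent* if their face lattices are isomorphic. Then every Veronese $3$-polytope is combinatorially equivalent either to a standard cyclic polytope $\operatorname{conv}\{(1,t,t^2,t^3) : t\in T\}$ for some finite $T\subset\mathbb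 R$ with $|T|\ge 4$, or to the octahedron $\operatorname{conv}\{\pm e_1,\pm e_2,\pm e_3\}\subset\mathbb R^3$. -/

import Mathlib

open scoped TensorProduct LinearAlgebra.Projectivization

/-! ### Polytopes, face lattices, combinatorial equivalence -/

/-- A polytope: the convex hull of finitely many points of a real vector space. -/
def IsPolytope {E : Type*} [AddCommGroup E] [Module ℝ E] (P : Set E) : Prop :=
  ∃ S : Set E, S.Finite ∧ P = convexHull ℝ S

/-- The dimension of a polytope, i.e. the dimension of its affine hull. -/
noncomputable def polytopeDim {E : Type*} [AddCommGroup E] [Module ℝ E] (P : Set E) : ℕ :=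
  Module.finrank ℝ (vectorSpan ℝ P)

/-- `F` is a face of `P`: there is a linear inequality `f x ≤ c` valid on `P` such that `F` is the
set of points of `P` where it is an equality. In particular `∅` (`f = 0`, `c = 1`) and
`P` (`f = 0`, `c = 0`) are faces. -/
def IsPolytopeFace {E : Type*} [AddCommGroup E] [Module ℝ E] (P F : Set E) : Prop :=
  ∃ (f : Module.Dual ℝ E) (c : ℝ), (∀ x ∈ P, f x ≤ c) ∧ F = {x ∈ P | f x = c}

/-- The poset of all faces of `P`, ordered by inclusion. -/
abbrev PolytopeFaces {E : Type*} [AddCommGroup E] [Module ℝ E] (P : Set E) : Type _ :=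
  {F : Set E // IsPolytopeFace P F}

/-- Two polytopes are combinatorially equivalent if their face lattices are isomorphic. -/
def CombinatoriallyEquivalent {E E' : Type*} [AddCommGroup E] [Module ℝ E]
    [AddCommGroup E'] [Module ℝ E'] (P : Set E) (Q : Set E') : Prop :=
  Nonempty (PolytopeFaces P ≃o PolytopeFaces Q)

/-- The moment curve `t ↦ (1, t, t², …, t^d)` in `ℝ^(d+1)`. -/
def momentCurve (d : ℕ) (t : ℝ) : Fin (d + 1) → ℝ := fun i => t ^ (i : ℕ)

/-- A cyclic `d`-polytope: a polytope combinatorially equivalent to a standard cyclic polytope,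
the convex hull of `n ≥ d + 1` points on the moment curve. -/
def IsCyclicPolytope (d : ℕ) {E : Type*} [AddCommGroup E] [Module ℝ E] (P : Set E) : Prop :=
  IsPolytope P ∧ ∃ T : Finset ℝ, d + 1 ≤ T.card ∧
    CombinatoriallyEquivalent P (convexHull ℝ (momentCurve d '' (T : Set ℝ)))

/-- The standard `d`-dimensional cross-polytope, the convex hull of `± e₁, …, ± e_d` in `ℝ^d`;
for `d = 3` it is the octahedron. -/
def crossPolytope (d : ℕ) : Set (Fin d → ℝ) :=
  convexHull ℝ {x | ∃ i : Fin d, x = Pi.single i 1 ∨ x = -Pi.single i 1}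

/-! ### The Veronese factorization structure `S^d V ⊆ V^{⊗ d}`, `V = W*`, and its curve -/

/-- The space `S^d V` of symmetric tensors inside `V^{⊗ d}`: the tensors that are fixed by every
permutation of the `d` tensor factors. -/
def symmetricTensors (d : ℕ) (V : Type*) [AddCommGroup V] [Module ℝ V] :
    Submodule ℝ (⨂[ℝ] _ : Fin d, V) where
  carrier := {t | ∀ π : Equiv.Perm (Fin d), PiTensorProduct.reindex ℝ (fun _ => V) π t = t}
  add_mem' := fun {a b} ha hb π => by
    have h := map_add (PiTensorProduct.reindex ℝ (fun _ : Fin d => V) π) a b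
    rw [ha π, hb π] at h
    exact h
  zero_mem' := fun π => map_zero (PiTensorProduct.reindex ℝ (fun _ : Fin d => V) π)
  smul_mem' := fun c a ha π => by
    have h := map_smul (PiTensorProduct.reindex ℝ (fun _ : Fin d => V) π) c a
    rw [ha π] at h
    exact h

/-- The symmetric tensor `α ⊗ ⋯ ⊗ α` (`d` factors). -/
noncomputable def tensorPow (d : ℕ) {V : Type*} [AddCommGroup V] [Module ℝ V] (α : V) :
    symmetricTensors d V :=
  ⟨PiTensorProduct.tprod ℝ (fun _ : Fin d => α), fun π =>
    PiTensorProduct.reindex_tprod (R := ℝ) (s := fun _ : Fin d => V) π (fun _ => α)⟩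

/-- The factorization curve of the Veronese factorization structure, as a map sending a line
`L ⊆ V` to the line `L^{⊗ d} ⊆ S^d V`. For `V = W*` and `L = ℓ⁰` the annihilator of a line
`ℓ ⊆ W`, this is `ψ(ℓ) = (ℓ⁰)^{⊗ d}`; when `W` is two-dimensional, `ℓ ↦ ℓ⁰` is a bijection from the
lines of `W` onto the lines of `V`, and every two-dimensional `V` is of the form `W*`. -/
noncomputable def veroneseCurve (d : ℕ) {V : Type*} [AddCommGroup V] [Module ℝ V] (L : ℙ ℝ V) :
    Submodule ℝ (symmetricTensors d V) :=
  Submodule.span ℝ (tensorPow d '' (L.submodule : Set V))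

/-- `v` generates an extremal ray of the cone `C`. -/
def GeneratesExtremalRay {E : Type*} [AddCommGroup E] [Module ℝ E]
    (C : PointedCone ℝ E) (v : E) : Prop :=
  v ∈ C ∧ v ≠ 0 ∧ ∀ x ∈ C, ∀ y ∈ C, x + y = v → ∃ a : ℝ, 0 ≤ a ∧ x = a • v

/-- A cone in `S^d V` compatible with the Veronese factorization structure: a full-dimensional
pointed (i.e. containing no line) convex polyhedral (i.e. finitely generated) cone whose
projectivised extremal rays lie on the factorization curve. -/
structure IsVeroneseCone (d : ℕ) {V : Type*} [AddCommGroup V] [Module ℝ V]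
    (C : PointedCone ℝ (symmetricTensors d V)) : Prop where
  polyhedral : C.FG
  fullDimensional : Submodule.span ℝ (C : Set (symmetricTensors d V)) = ⊤
  pointed : ∀ v ∈ C, -v ∈ C → v = 0
  extremal : ∀ v, GeneratesExtremalRay C v →
    ∃ L : ℙ ℝ V, Submodule.span ℝ {v} = veroneseCurve d L

/-- A Veronese polytope: a polytope that is the section of a cone compatible with the Veronese
factorization structure by an affine hyperplane `{x | ξ x = c}`. -/
def IsVeronesePolytope (d : ℕ) {V : Type*} [AddCommGroup V] [Module ℝ V]
    (P : Set (symmetricTensors d V)) : Prop :=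
  IsPolytope P ∧ ∃ C : PointedCone ℝ (symmetricTensors d V), IsVeroneseCone d C ∧
    ∃ (ξ : Module.Dual ℝ (symmetricTensors d V)) (c : ℝ), ξ ≠ 0 ∧ P = {x | x ∈ C ∧ ξ x = c}

/-! A face of a convex hull is determined by the set of generators on which its supporting
inequality is tight, so the face lattice is the poset of these supports. Linear functionals on `S^3
V`, evaluated at cubes `w ⊗ w ⊗ w`, are exactly the binary cubic forms in `w`. On the level `ξ = 1`
the constant of an inequality can be absorbed into the functional. Supports thus become zero sets of
binary cubics that are nonpositive on plane vectors `w i`, and they depend only on the rays through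
these vectors. The moment curve is the case of the vectors `(1, t)`.

The vertices of `P` span extremal rays of the cone. Since every real number is a cube, they are
cubes of vectors `w` on which the binary cubic `ξ` equals `1`. If the set `ξ > 0` lies in a half
plane, a linear change of coordinates and positive scaling turn the vectors into `(1, t)`, and `P`
is cyclic. Otherwise `ξ` has three distinct real roots and `ξ > 0` consists of three arcs
(`binaryCubic_pos_halfPlane_or_three_arcs`). If one arc contains no vertex, the other two lie in a
half plane.

There remain three occupied arcs. Five cubes satisfy one linear relation, whose coefficients are
signed products of `2 × 2` determinants (`sum_cubicRelation_mul`). Its signs show that the middle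
one of three points on an arc is redundant, so each arc carries one or two vertices. Four vertices
give a simplex. Five have the Radon partition of a cyclic polytope, of two points against three
(`IsArcFive.isCubicSupport_iff`). Six give the octahedron (`IsArcSix.isCubicSupport_iff`). -/

/-! ### Supports of faces of a finite point configuration -/

/-- `I` is the set of indices of the points of the configuration `p` lying on some face of the
convex hull of `p`. -/
def IsFaceSupport {ι E : Type*} [AddCommGroup E] [Module ℝ E] (p : ι → E) (I : Set ι) : Prop :=
  ∃ (f : Module.Dual ℝ E) (c : ℝ), ∀ i, f (p i) ≤ c ∧ (f (p i) = c ↔ i ∈ I)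

section FaceSupport

variable {ι E E' : Type*} [AddCommGroup E] [Module ℝ E] [AddCommGroup E'] [Module ℝ E']

theorem dual_le_of_mem_convexHull {S : Set E} {f : Module.Dual ℝ E} {c : ℝ}
    (h : ∀ x ∈ S, f x ≤ c) {x : E} (hx : x ∈ convexHull ℝ S) : f x ≤ c :=
  convexHull_min (s := S) (t := {x | f x ≤ c}) h (convex_halfSpace_le f.isLinear c) hx

/-- A point of the convex hull at which a valid inequality is tight is a convex combination of
points at which it is tight. -/
theorem mem_convexHull_inter_of_dual_eq {S : Set E} {f : Module.Dual ℝ E} {c : ℝ}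
    (h : ∀ x ∈ S, f x ≤ c) {x : E} (hx : x ∈ convexHull ℝ S) (hxc : f x = c) :
    x ∈ convexHull ℝ (S ∩ {y | f y = c}) := by
  have key : convexHull ℝ S ⊆ {x | f x ≤ c ∧ (f x = c → x ∈ convexHull ℝ (S ∩ {y | f y = c}))} := by
    refine convexHull_min (fun y hy => ⟨h y hy, fun e => subset_convexHull ℝ _ ⟨hy, e⟩⟩) ?_
    rintro y ⟨hy, hy'⟩ z ⟨hz, hz'⟩ a b ha hb hab
    have e : f (a • y + b • z) = a * f y + b * f z := by simp
    refine ⟨by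
      rw [e]
      have h1 := mul_le_mul_of_nonneg_left hy ha
      have h2 := mul_le_mul_of_nonneg_left hz hb
      have h3 : a * c + b * c = c := by rw [← add_mul, hab, one_mul]
      linarith, fun he => ?_⟩
    rw [e] at he
    -- The weighted slacks are nonnegative with sum zero, so both vanish; a point with positive
    -- weight is then tight itself.
    have h0 : a * (c - f y) + b * (c - f z) = 0 := by linear_combination c * hab - he
    have h1 := mul_nonneg ha (sub_nonneg.2 hy)
    have h2 := mul_nonneg hb (sub_nonneg.2 hz)
    have h3 : a * (c - f y) = 0 := by linarith
    have h4 : b * (c - f z) = 0 := by linarith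
    rcases mul_eq_zero.1 h3 with ha0 | hy0
    · subst ha0
      have : b = 1 := by linarith
      subst this
      have := hz' (by linarith)
      simpa using this
    · rcases mul_eq_zero.1 h4 with hb0 | hz0
      · subst hb0
        have : a = 1 := by linarith
        subst this
        have := hy' (by linarith)
        simpa using this
      · exact convex_convexHull ℝ _ (hy' (by linarith)) (hz' (by linarith)) ha hb hab
  exact (key hx).2 hxc

theorem IsPolytopeFace.isFaceSupport {p : ι → E} {F : Set E}
    (h : IsPolytopeFace (convexHull ℝ (Set.range p)) F) : IsFaceSupport p {i | p i ∈ F} := by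
  obtain ⟨f, c, hf, rfl⟩ := h
  have hp : ∀ i, p i ∈ convexHull ℝ (Set.range p) := fun i => subset_convexHull ℝ _ ⟨i, rfl⟩
  exact ⟨f, c, fun i => ⟨hf _ (hp i), fun e => ⟨hp i, e⟩, fun e => e.2⟩⟩

/-- This recovers a face from its support, which makes the passage to supports injective and
order-reflecting. -/
theorem IsPolytopeFace.eq_convexHull_image {p : ι → E} {F : Set E}
    (h : IsPolytopeFace (convexHull ℝ (Set.range p)) F) :
    F = convexHull ℝ (p '' {i | p i ∈ F}) := by
  obtain ⟨f, c, hf, rfl⟩ := h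
  have hp : ∀ x ∈ Set.range p, x ∈ convexHull ℝ (Set.range p) := fun x hx =>
    subset_convexHull ℝ _ hx
  refine Set.Subset.antisymm ?_ ?_
  · rintro x ⟨hx, hxc⟩
    refine convexHull_mono ?_ (mem_convexHull_inter_of_dual_eq (fun y hy => hf y (hp y hy)) hx hxc)
    rintro _ ⟨⟨i, rfl⟩, hi⟩
    exact ⟨i, ⟨hp _ ⟨i, rfl⟩, hi⟩, rfl⟩
  · refine convexHull_min ?_ ?_
    · rintro _ ⟨i, hi, rfl⟩
      exact hi
    · exact (convex_convexHull ℝ _).inter (convex_hyperplane f.isLinear c)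

theorem IsFaceSupport.exists_face {p : ι → E} {I : Set ι} (h : IsFaceSupport p I) :
    ∃ F, IsPolytopeFace (convexHull ℝ (Set.range p)) F ∧ {i | p i ∈ F} = I := by
  obtain ⟨f, c, hf⟩ := h
  refine ⟨_, ⟨f, c, fun x hx => ?_, rfl⟩, ?_⟩
  · exact dual_le_of_mem_convexHull (by rintro _ ⟨i, rfl⟩; exact (hf i).1) hx
  · ext i
    exact ⟨fun e => (hf i).2.1 e.2, fun e => ⟨subset_convexHull ℝ _ ⟨i, rfl⟩, (hf i).2.2 e⟩⟩

/-- The face lattice of the convex hull of a configuration is the poset of its face supports. -/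
noncomputable def faceSupportIso (p : ι → E) :
    PolytopeFaces (convexHull ℝ (Set.range p)) ≃o {I : Set ι // IsFaceSupport p I} where
  toFun F := ⟨{i | p i ∈ F.1}, F.2.isFaceSupport⟩
  invFun I := ⟨I.2.exists_face.choose, I.2.exists_face.choose_spec.1⟩
  left_inv F := by
    apply Subtype.ext
    have h := (IsPolytopeFace.isFaceSupport F.2).exists_face.choose_spec
    have h1 := h.1.eq_convexHull_image
    rw [h.2] at h1
    exact h1.trans F.2.eq_convexHull_image.symm
  right_inv I := Subtype.ext I.2.exists_face.choose_spec.2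
  map_rel_iff' := by
    intro F G
    refine ⟨fun h => ?_, fun h i hi => h hi⟩
    change F.1 ⊆ G.1
    rw [F.2.eq_convexHull_image, G.2.eq_convexHull_image]
    exact convexHull_mono (Set.image_mono h)

theorem combinatoriallyEquivalent_of_isFaceSupport_iff {p : ι → E} {q : ι → E'}
    (h : ∀ I, IsFaceSupport p I ↔ IsFaceSupport q I) :
    CombinatoriallyEquivalent (convexHull ℝ (Set.range p)) (convexHull ℝ (Set.range q)) :=
  ⟨(faceSupportIso p).trans ((OrderIso.setCongr {I | IsFaceSupport p I} {I | IsFaceSupport q I}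
    (Set.ext h)).trans (faceSupportIso q).symm)⟩

end FaceSupport

/-! ### Binary cubics and linear functionals on symmetric tensors -/

/-- The binary cubic form with coefficients `k`. -/
def binaryCubic (k : Fin 4 → ℝ) (w : ℝ × ℝ) : ℝ :=
  k 0 * w.1 ^ 3 + k 1 * w.1 ^ 2 * w.2 + k 2 * w.1 * w.2 ^ 2 + k 3 * w.2 ^ 3

/-- `I` is the zero set of a binary cubic form which is nonpositive on the vectors `w i`. -/
def IsCubicSupport {ι : Type*} (w : ι → ℝ × ℝ) (I : Set ι) : Prop :=
  ∃ k, ∀ i, binaryCubic k (w i) ≤ 0 ∧ (binaryCubic k (w i) = 0 ↔ i ∈ I)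

section Functionals

variable {V : Type*} [AddCommGroup V] [Module ℝ V]

theorem tensorPow_smul (d : ℕ) (c : ℝ) (v : V) : tensorPow d (c • v) = c ^ d • tensorPow d v := by
  apply Subtype.ext
  have := (PiTensorProduct.tprod ℝ).map_smul_univ (fun _ : Fin d => c) (fun _ : Fin d => v)
  simpa [tensorPow] using this

/-- Extend the functional to the whole tensor power and expand the resulting trilinear form in the
basis `a`, `b`; the mixed terms of equal degree add up to one coefficient. -/
theorem exists_binaryCubic_eq_dual (e : V ≃ₗ[ℝ] ℝ × ℝ)
    (h : Module.Dual ℝ (symmetricTensors 3 V)) :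
    ∃ k, ∀ w, h (tensorPow 3 w) = binaryCubic k (e w) := by
  obtain ⟨H, hH⟩ := LinearMap.exists_extend h
  set m := H.compMultilinearMap (PiTensorProduct.tprod ℝ (s := fun _ : Fin 3 => V)) with hm
  set a := e.symm (1, 0) with ha
  set b := e.symm (0, 1) with hb
  have hw : ∀ w, h (tensorPow 3 w) = m (fun _ => w) := fun w => by
    rw [← hH]; rfl
  have up0 : ∀ u v w x : V, Function.update ![u, v, w] 0 x = ![x, v, w] := fun u v w x => by
    ext i; fin_cases i <;> rfl
  have up1 : ∀ u v w x : V, Function.update ![u, v, w] 1 x = ![u, x, w] := fun u v w x => by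
    ext i; fin_cases i <;> rfl
  have up2 : ∀ u v w x : V, Function.update ![u, v, w] 2 x = ![u, v, x] := fun u v w x => by
    ext i; fin_cases i <;> rfl
  have ad0 : ∀ u u' v w : V, m ![u + u', v, w] = m ![u, v, w] + m ![u', v, w] := by
    intro u u' v w
    simpa only [up0] using m.map_update_add ![u, v, w] 0 u u'
  have ad1 : ∀ u v v' w : V, m ![u, v + v', w] = m ![u, v, w] + m ![u, v', w] := by
    intro u v v' w
    simpa only [up1] using m.map_update_add ![u, v, w] 1 v v'
  have ad2 : ∀ u v w w' : V, m ![u, v, w + w'] = m ![u, v, w] + m ![u, v, w'] := by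
    intro u v w w'
    simpa only [up2] using m.map_update_add ![u, v, w] 2 w w'
  have sm0 : ∀ (c : ℝ) (u v w : V), m ![c • u, v, w] = c * m ![u, v, w] := by
    intro c u v w
    simpa only [up0, smul_eq_mul] using m.map_update_smul ![u, v, w] 0 c u
  have sm1 : ∀ (c : ℝ) (u v w : V), m ![u, c • v, w] = c * m ![u, v, w] := by
    intro c u v w
    simpa only [up1, smul_eq_mul] using m.map_update_smul ![u, v, w] 1 c v
  have sm2 : ∀ (c : ℝ) (u v w : V), m ![u, v, c • w] = c * m ![u, v, w] := by
    intro c u v w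
    simpa only [up2, smul_eq_mul] using m.map_update_smul ![u, v, w] 2 c w
  refine ⟨![m ![a, a, a], m ![a, a, b] + m ![a, b, a] + m ![b, a, a],
    m ![a, b, b] + m ![b, a, b] + m ![b, b, a], m ![b, b, b]], fun w => ?_⟩
  have hwab : w = (e w).1 • a + (e w).2 • b := by
    apply e.injective
    ext <;> simp [ha, hb]
  rw [hw]
  have : (fun _ : Fin 3 => w) = ![w, w, w] := by
    ext i; fin_cases i <;> rfl
  rw [this]
  conv_lhs => rw [hwab]
  simp only [ad0, ad1, ad2, sm0, sm1, sm2, binaryCubic]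
  simp
  ring

theorem exists_dual_eq_mul (f : Fin 3 → Module.Dual ℝ V) :
    ∃ h : Module.Dual ℝ (symmetricTensors 3 V),
      ∀ w, h (tensorPow 3 w) = f 0 w * f 1 w * f 2 w := by
  refine ⟨(PiTensorProduct.lift ((MultilinearMap.mkPiAlgebra ℝ (Fin 3) ℝ).compLinearMap f)).comp
    (symmetricTensors 3 V).subtype, fun w => ?_⟩
  simp [tensorPow, Fin.prod_univ_three]

theorem exists_dual_eq_binaryCubic (e : V ≃ₗ[ℝ] ℝ × ℝ) (k : Fin 4 → ℝ) :
    ∃ h : Module.Dual ℝ (symmetricTensors 3 V), ∀ w, h (tensorPow 3 w) = binaryCubic k (e w) := by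
  let x : Module.Dual ℝ V := (LinearMap.fst ℝ ℝ ℝ).comp e.toLinearMap
  let y : Module.Dual ℝ V := (LinearMap.snd ℝ ℝ ℝ).comp e.toLinearMap
  obtain ⟨h0, e0⟩ := exists_dual_eq_mul ![x, x, x]
  obtain ⟨h1, e1⟩ := exists_dual_eq_mul ![x, x, y]
  obtain ⟨h2, e2⟩ := exists_dual_eq_mul ![x, y, y]
  obtain ⟨h3, e3⟩ := exists_dual_eq_mul ![y, y, y]
  refine ⟨k 0 • h0 + k 1 • h1 + k 2 • h2 + k 3 • h3, fun w => ?_⟩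
  simp [e0, e1, e2, e3, binaryCubic, x, y]
  ring

/-- Since `ξ` is `1` at all points, `f ≤ c` is the homogeneous inequality `f - c • ξ ≤ 0`. -/
theorem isFaceSupport_tensorPow_iff {ι : Type*} (e : V ≃ₗ[ℝ] ℝ × ℝ)
    {ξ : Module.Dual ℝ (symmetricTensors 3 V)} {w : ι → V} (hξ : ∀ i, ξ (tensorPow 3 (w i)) = 1)
    (I : Set ι) :
    IsFaceSupport (fun i => tensorPow 3 (w i)) I ↔ IsCubicSupport (fun i => e (w i)) I := by
  constructor
  · rintro ⟨f, c, hf⟩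
    obtain ⟨k, hk⟩ := exists_binaryCubic_eq_dual e (f - c • ξ)
    refine ⟨k, fun i => ?_⟩
    rw [← hk]
    simpa [hξ i, sub_eq_zero] using hf i
  · rintro ⟨k, hk⟩
    obtain ⟨h, hh⟩ := exists_dual_eq_binaryCubic e k
    refine ⟨h, 0, fun i => ?_⟩
    rw [hh]
    exact hk i

theorem isFaceSupport_momentCurve_iff {ι : Type*} (t : ι → ℝ) (I : Set ι) :
    IsFaceSupport (fun i => momentCurve 3 (t i)) I ↔ IsCubicSupport (fun i => (1, t i)) I := by
  constructor
  · rintro ⟨f, c, hf⟩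
    refine ⟨![f (Pi.single 0 1) - c, f (Pi.single 1 1), f (Pi.single 2 1), f (Pi.single 3 1)],
      fun i => ?_⟩
    have h : f (momentCurve 3 (t i)) - c = binaryCubic ![f (Pi.single 0 1) - c, f (Pi.single 1 1),
        f (Pi.single 2 1), f (Pi.single 3 1)] (1, t i) := by
      have hm : momentCurve 3 (t i) = Pi.single 0 1 + t i • Pi.single 1 1 +
          t i ^ 2 • Pi.single 2 1 + t i ^ 3 • Pi.single 3 1 := by
        ext j
        fin_cases j <;> simp [momentCurve]
      rw [hm]
      simp [binaryCubic]
      ring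
    rw [← h]
    simpa [sub_eq_zero] using hf i
  · rintro ⟨k, hk⟩
    refine ⟨∑ j, k j • LinearMap.proj j, 0, fun i => ?_⟩
    have h : (∑ j, k j • LinearMap.proj (R := ℝ) (φ := fun _ : Fin 4 => ℝ) j) (momentCurve 3 (t i))
        = binaryCubic k (1, t i) := by
      simp [Fin.sum_univ_four, momentCurve, binaryCubic]
    rw [h]
    exact hk i

end Functionals

/-! ### Classification of real binary cubics -/

theorem exists_root_monic_cubic (b c d : ℝ) : ∃ t : ℝ, t ^ 3 + b * t ^ 2 + c * t + d = 0 := by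
  -- A Cauchy bound: at `±M` the leading term dominates, so the signs at the endpoints differ.
  set M := 1 + |b| + |c| + |d| with hM
  have hb := abs_nonneg b
  have hc := abs_nonneg c
  have hd := abs_nonneg d
  have hM1 : 1 ≤ M := by linarith
  have hM2 : M ≤ M ^ 2 := by nlinarith
  have hM3 : M ^ 3 = M ^ 2 + |b| * M ^ 2 + |c| * M ^ 2 + |d| * M ^ 2 := by
    rw [pow_succ]; nth_rewrite 2 [hM]; ring
  have b1 := mul_le_mul_of_nonneg_right (le_abs_self b) (sq_nonneg M)
  have b2 := mul_le_mul_of_nonneg_right (neg_abs_le b) (sq_nonneg M)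
  have c1 := mul_le_mul_of_nonneg_right (le_abs_self c) (by linarith : 0 ≤ M)
  have c2 := mul_le_mul_of_nonneg_right (neg_abs_le c) (by linarith : 0 ≤ M)
  have c3 := mul_le_mul_of_nonneg_left hM2 hc
  have d1 := le_abs_self d
  have d2 := neg_abs_le d
  have d3 := mul_le_mul_of_nonneg_left (hM1.trans hM2) hd
  have hf : ContinuousOn (fun t : ℝ => t ^ 3 + b * t ^ 2 + c * t + d) (Set.Icc (-M) M) := by
    fun_prop
  obtain ⟨t, -, ht⟩ := intermediate_value_Icc (by linarith : -M ≤ M) hf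
    (show (0 : ℝ) ∈ _ from ⟨by nlinarith, by nlinarith⟩)
  exact ⟨t, ht⟩

theorem exists_cube_eq (s : ℝ) : ∃ r : ℝ, r ^ 3 = s := by
  obtain ⟨t, ht⟩ := exists_root_monic_cubic 0 0 (-s)
  exact ⟨t, by linarith⟩

theorem exists_linear_factor (k : Fin 4 → ℝ) :
    ∃ p q A B C : ℝ, ∀ w : ℝ × ℝ, binaryCubic k w =
      (p * w.1 + q * w.2) * (A * w.1 ^ 2 + B * w.1 * w.2 + C * w.2 ^ 2) := by
  by_cases h0 : k 0 = 0
  · refine ⟨0, 1, k 1, k 2, k 3, fun w => ?_⟩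
    rw [binaryCubic, h0]; ring
  · obtain ⟨r, hr⟩ := exists_root_monic_cubic (k 1 / k 0) (k 2 / k 0) (k 3 / k 0)
    have hr' : k 0 * r ^ 3 + k 1 * r ^ 2 + k 2 * r + k 3 = 0 := by
      field_simp at hr; linear_combination hr
    refine ⟨1, -r, k 0, k 1 + k 0 * r, k 2 + k 1 * r + k 0 * r ^ 2, fun w => ?_⟩
    rw [binaryCubic]
    linear_combination w.2 ^ 3 * hr'

theorem quadratic_semidefinite_or_factor (A B C : ℝ) :
    (∀ x y : ℝ, 0 ≤ A * x ^ 2 + B * x * y + C * y ^ 2) ∨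
    (∀ x y : ℝ, A * x ^ 2 + B * x * y + C * y ^ 2 ≤ 0) ∨
    ∃ a b c d : ℝ, a * d - b * c ≠ 0 ∧
      ∀ x y : ℝ, A * x ^ 2 + B * x * y + C * y ^ 2 = (a * x + b * y) * (c * x + d * y) := by
  rcases le_or_gt (B ^ 2 - 4 * A * C) 0 with hD | hD
  · have key : ∀ x y : ℝ, 0 ≤ A * (A * x ^ 2 + B * x * y + C * y ^ 2) := fun x y => by
      nlinarith [sq_nonneg (2 * A * x + B * y), mul_nonneg (sub_nonneg.2 hD) (sq_nonneg y)]
    rcases lt_trichotomy A 0 with hA | hA | hA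
    · right; left
      intro x y
      have := key x y
      by_contra! h
      nlinarith [mul_neg_of_neg_of_pos hA h]
    · subst hA
      have hB : B = 0 := by nlinarith [sq_nonneg B]
      subst hB
      rcases le_total 0 C with hC | hC
      · left; intro x y; nlinarith [mul_nonneg hC (sq_nonneg y)]
      · right; left; intro x y; nlinarith [mul_nonneg (neg_nonneg.2 hC) (sq_nonneg y)]
    · left
      intro x y
      exact nonneg_of_mul_nonneg_right (key x y) hA
  · right; right
    by_cases hA : A = 0
    · subst hA
      have hB : B ≠ 0 := by rintro rfl; simp at hD
      exact ⟨0, 1, B, C, by simpa using hB, fun x y => by ring⟩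
    · set s := Real.sqrt (B ^ 2 - 4 * A * C) with hs
      have hs2 : s ^ 2 = B ^ 2 - 4 * A * C := Real.sq_sqrt hD.le
      have hs0 : 0 < s := Real.sqrt_pos.2 hD
      refine ⟨A, (B + s) / 2, 1, (B - s) / (2 * A), ?_, fun x y => ?_⟩
      · have : A * ((B - s) / (2 * A)) - (B + s) / 2 * 1 = -s := by field_simp; ring
        rw [this]
        exact neg_ne_zero.2 hs0.ne'
      · field_simp
        linear_combination y ^ 2 * hs2

/-- The positivity region of a real binary cubic either lies in a half plane or consists of the
three arcs `u > 0 > v, w` etc. for linear forms `u + v + w = 0`. -/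
theorem binaryCubic_pos_halfPlane_or_three_arcs (k : Fin 4 → ℝ) :
    (∃ α β : ℝ, ∀ w : ℝ × ℝ, 0 < binaryCubic k w → 0 < α * w.1 + β * w.2) ∨
    ∃ α β γ δ : ℝ, α * δ - β * γ ≠ 0 ∧ ∀ w : ℝ × ℝ, binaryCubic k w =
      -((α * w.1 + β * w.2) * (γ * w.1 + δ * w.2) *
        ((α * w.1 + β * w.2) + (γ * w.1 + δ * w.2))) := by
  obtain ⟨p, q, A, B, C, hk⟩ := exists_linear_factor k
  rcases quadratic_semidefinite_or_factor A B C with h | h | ⟨a, b, c, d, hdet, h⟩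
  · left
    refine ⟨p, q, fun w hw => ?_⟩
    rw [hk] at hw
    exact pos_of_mul_pos_left hw (h _ _)
  · left
    refine ⟨-p, -q, fun w hw => ?_⟩
    rw [hk] at hw
    have := h w.1 w.2
    by_contra! hn
    nlinarith [mul_nonneg (by linarith : 0 ≤ p * w.1 + q * w.2) (neg_nonneg.2 this)]
  · have hk' : ∀ w : ℝ × ℝ, binaryCubic k w =
        (p * w.1 + q * w.2) * ((a * w.1 + b * w.2) * (c * w.1 + d * w.2)) := fun w => by
      rw [hk, h]
    -- If the first factor is proportional to another one, the cubic is a linear form times a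
    -- square, and it is positive only where that form is.
    by_cases h1 : p * b - q * a = 0
    · left
      have h2 : ∃ r, p = r * a ∧ q = r * b := by
        by_cases ha : a = 0
        · have hb : b ≠ 0 := by rintro rfl; apply hdet; rw [ha]; ring
          exact ⟨q / b, by subst ha; simpa [hb] using h1, by field_simp⟩
        · exact ⟨p / a, by field_simp, by field_simp; linarith⟩
      obtain ⟨r, rfl, rfl⟩ := h2
      refine ⟨r * c, r * d, fun w hw => ?_⟩
      rw [hk'] at hw
      have e : (r * a * w.1 + r * b * w.2) * ((a * w.1 + b * w.2) * (c * w.1 + d * w.2)) =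
        (r * c * w.1 + r * d * w.2) * (a * w.1 + b * w.2) ^ 2 := by ring
      rw [e] at hw
      exact pos_of_mul_pos_left hw (sq_nonneg _)
    by_cases h2 : p * d - q * c = 0
    · left
      have h2 : ∃ r, p = r * c ∧ q = r * d := by
        by_cases hc : c = 0
        · have hd : d ≠ 0 := by rintro rfl; apply hdet; rw [hc]; ring
          exact ⟨q / d, by subst hc; simpa [hd] using h2, by field_simp⟩
        · exact ⟨p / c, by field_simp, by field_simp; linarith⟩
      obtain ⟨r, rfl, rfl⟩ := h2
      refine ⟨r * a, r * b, fun w hw => ?_⟩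
      rw [hk'] at hw
      have e : (r * c * w.1 + r * d * w.2) * ((a * w.1 + b * w.2) * (c * w.1 + d * w.2)) =
        (r * a * w.1 + r * b * w.2) * (c * w.1 + d * w.2) ^ 2 := by ring
      rw [e] at hw
      exact pos_of_mul_pos_left hw (sq_nonneg _)
    right
    -- The linear forms `l₁ = (p, q)`, `l₂ = (a, b)`, `l₃ = (c, d)` satisfy `D l₁ + P l₂ + Q l₃ =
    -- 0`. The common factor `r` makes the product of the three rescaled forms equal to `l₁ l₂ l₃`.
    set D := a * d - b * c with hD
    set P := -(p * d - q * c) with hP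
    set Q := p * b - q * a with hQ
    have hP0 : P ≠ 0 := neg_ne_zero.2 h2
    obtain ⟨r, hr⟩ := exists_cube_eq (1 / (D * P * Q))
    have hr' : r ^ 3 * (D * P * Q) = 1 := by rw [hr]; field_simp
    have hr0 : r ≠ 0 := by rintro rfl; norm_num at hr'
    refine ⟨r * D * p, r * D * q, r * P * a, r * P * b, ?_, fun w => ?_⟩
    · have : r * D * p * (r * P * b) - r * D * q * (r * P * a) = r ^ 2 * D * P * Q := by
        rw [hQ]; ring
      rw [this]
      positivity
    · have e : r * D * p * w.1 + r * D * q * w.2 + (r * P * a * w.1 + r * P * b * w.2) =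
          -(r * Q * (c * w.1 + d * w.2)) := by
        rw [hD, hP, hQ]; ring
      rw [hk', e]
      linear_combination -(p * w.1 + q * w.2) * ((a * w.1 + b * w.2) * (c * w.1 + d * w.2)) * hr'

/-! ### Values of binary cubics on four, five and six vectors -/

/-- The determinant of two plane vectors. -/
def planeDet (v w : ℝ × ℝ) : ℝ := v.1 * w.2 - w.1 * v.2

theorem planeDet_swap (v w : ℝ × ℝ) : planeDet v w = -planeDet w v := by
  simp only [planeDet]; ring

theorem exists_binaryCubic_eq_mul (f g h : ℝ × ℝ) :
    ∃ k, ∀ w : ℝ × ℝ, binaryCubic k w =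
      (f.1 * w.1 + f.2 * w.2) * (g.1 * w.1 + g.2 * w.2) * (h.1 * w.1 + h.2 * w.2) := by
  refine ⟨![f.1 * g.1 * h.1, f.1 * g.1 * h.2 + f.1 * g.2 * h.1 + f.2 * g.1 * h.1,
    f.1 * g.2 * h.2 + f.2 * g.1 * h.2 + f.2 * g.2 * h.1, f.2 * g.2 * h.2], fun w => ?_⟩
  simp [binaryCubic]
  ring

theorem exists_binaryCubic_eq_planeDet_mul (a b c : ℝ × ℝ) :
    ∃ k, ∀ w : ℝ × ℝ, binaryCubic k w = planeDet w a * planeDet w b * planeDet w c := by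
  obtain ⟨k, hk⟩ := exists_binaryCubic_eq_mul (a.2, -a.1) (b.2, -b.1) (c.2, -c.1)
  refine ⟨k, fun w => ?_⟩
  rw [hk]
  simp only [planeDet]
  ring

theorem binaryCubic_add (k l : Fin 4 → ℝ) (w : ℝ × ℝ) :
    binaryCubic (k + l) w = binaryCubic k w + binaryCubic l w := by
  simp only [binaryCubic, Pi.add_apply]; ring

theorem binaryCubic_smul (c : ℝ) (k : Fin 4 → ℝ) (w : ℝ × ℝ) :
    binaryCubic (c • k) w = c * binaryCubic k w := by
  simp only [binaryCubic, Pi.smul_apply, smul_eq_mul]; ring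

/-- A binary cubic vanishing at `b`, `c`, `d` and equal to `s` at `a`. -/
theorem exists_binaryCubic_single {a b c d : ℝ × ℝ} (hb : planeDet a b ≠ 0)
    (hc : planeDet a c ≠ 0) (hd : planeDet a d ≠ 0) (s : ℝ) :
    ∃ k, binaryCubic k a = s ∧ binaryCubic k b = 0 ∧ binaryCubic k c = 0 ∧
      binaryCubic k d = 0 := by
  obtain ⟨k, hk⟩ := exists_binaryCubic_eq_planeDet_mul b c d
  have h0 : ∀ v, planeDet v v = 0 := fun v => by simp [planeDet]
  refine ⟨(s / (planeDet a b * planeDet a c * planeDet a d)) • k, ?_, ?_, ?_, ?_⟩ <;>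
    rw [binaryCubic_smul, hk]
  · field_simp
  all_goals simp [h0]

theorem exists_binaryCubic_interpolation (w : Fin 4 → ℝ × ℝ)
    (hw : ∀ i j, i ≠ j → planeDet (w i) (w j) ≠ 0) (s : Fin 4 → ℝ) :
    ∃ k, ∀ i, binaryCubic k (w i) = s i := by
  have h : ∀ a b c d : Fin 4, a ≠ b → a ≠ c → a ≠ d → ∃ k, binaryCubic k (w a) = s a ∧
      binaryCubic k (w b) = 0 ∧ binaryCubic k (w c) = 0 ∧ binaryCubic k (w d) = 0 :=
    fun a b c d hb hc hd => exists_binaryCubic_single (hw _ _ hb) (hw _ _ hc) (hw _ _ hd) _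
  obtain ⟨k0, a0, a1, a2, a3⟩ := h 0 1 2 3 (by decide) (by decide) (by decide)
  obtain ⟨k1, b0, b1, b2, b3⟩ := h 1 0 2 3 (by decide) (by decide) (by decide)
  obtain ⟨k2, c0, c1, c2, c3⟩ := h 2 0 1 3 (by decide) (by decide) (by decide)
  obtain ⟨k3, d0, d1, d2, d3⟩ := h 3 0 1 2 (by decide) (by decide) (by decide)
  refine ⟨k0 + k1 + k2 + k3, fun i => ?_⟩
  simp only [binaryCubic_add]
  fin_cases i <;> simp [*]

/-- The coefficients of the linear relation between the cubes of five plane vectors. -/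
def cubicRelation (w : Fin 5 → ℝ × ℝ) : Fin 5 → ℝ :=
  ![planeDet (w 1) (w 2) * planeDet (w 1) (w 3) * planeDet (w 1) (w 4) *
      planeDet (w 2) (w 3) * planeDet (w 2) (w 4) * planeDet (w 3) (w 4),
    -(planeDet (w 0) (w 2) * planeDet (w 0) (w 3) * planeDet (w 0) (w 4) *
      planeDet (w 2) (w 3) * planeDet (w 2) (w 4) * planeDet (w 3) (w 4)),
    planeDet (w 0) (w 1) * planeDet (w 0) (w 3) * planeDet (w 0) (w 4) *
      planeDet (w 1) (w 3) * planeDet (w 1) (w 4) * planeDet (w 3) (w 4),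
    -(planeDet (w 0) (w 1) * planeDet (w 0) (w 2) * planeDet (w 0) (w 4) *
      planeDet (w 1) (w 2) * planeDet (w 1) (w 4) * planeDet (w 2) (w 4)),
    planeDet (w 0) (w 1) * planeDet (w 0) (w 2) * planeDet (w 0) (w 3) *
      planeDet (w 1) (w 2) * planeDet (w 1) (w 3) * planeDet (w 2) (w 3)]

-- Cramer's rule: up to a common sign, the coefficient at `i` is `(-1)^i` times the determinant of
-- the other four cubes, which is a homogeneous Vandermonde product.
set_option maxHeartbeats 1000000 in
theorem sum_cubicRelation_mul (w : Fin 5 → ℝ × ℝ) (k : Fin 4 → ℝ) :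
    ∑ i, cubicRelation w i * binaryCubic k (w i) = 0 := by
  rw [Fin.sum_univ_five]
  simp [cubicRelation, planeDet, binaryCubic]
  ring

/-! ### Vertices of Veronese polytopes -/

section Polytope

variable {E : Type*} [AddCommGroup E] [Module ℝ E]

theorem IsPolytope.exists_dual_le {P : Set E} (hP : IsPolytope P) (f : Module.Dual ℝ E) :
    ∃ c, ∀ x ∈ P, f x ≤ c := by
  obtain ⟨S, hS, rfl⟩ := hP
  obtain ⟨c, hc⟩ := (hS.image f).bddAbove
  exact ⟨c, fun x hx => dual_le_of_mem_convexHull (fun y hy => hc ⟨y, hy, rfl⟩) hx⟩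

theorem IsPolytope.eq_zero_of_add_smul_mem {P : Set E} (hP : IsPolytope P) {p u : E}
    (h : ∀ s : ℝ, 0 ≤ s → p + s • u ∈ P) : u = 0 := by
  rw [← Module.forall_dual_apply_eq_zero_iff ℝ u]
  by_contra! hne
  obtain ⟨f, hf⟩ : ∃ f : Module.Dual ℝ E, 0 < f u := by
    obtain ⟨f, hf⟩ := hne
    rcases lt_or_gt_of_ne hf with h | h
    · exact ⟨-f, by simpa using h⟩
    · exact ⟨f, h⟩
  obtain ⟨c, hc⟩ := hP.exists_dual_le f
  have h0 := hc _ (h 0 le_rfl)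
  simp only [zero_smul, add_zero] at h0
  have h1 := hc _ (h ((c - f p + 1) / f u) (div_nonneg (by linarith) hf.le))
  simp only [map_add, map_smul, smul_eq_mul, div_mul_cancel₀ _ hf.ne'] at h1
  linarith

/-- A polytope is the convex hull of finitely many points none of which is redundant. -/
theorem IsPolytope.exists_irredundant {P : Set E} (hP : IsPolytope P) :
    ∃ T : Set E, T.Finite ∧ P = convexHull ℝ T ∧ ∀ v ∈ T, v ∉ convexHull ℝ (T \ {v}) := by
  obtain ⟨S, hS, hPS⟩ := hP
  -- A minimal generating subset of `S`: a redundant point could be dropped.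
  obtain ⟨T, ⟨hTS, hT⟩, hmin⟩ := (hS.finite_subsets.subset
    (fun T hT => hT.1 : {T | T ⊆ S ∧ P = convexHull ℝ T} ⊆ {T | T ⊆ S})).exists_minimal
    ⟨S, subset_rfl, hPS⟩
  refine ⟨T, hS.subset hTS, hT, fun v hv hv' => ?_⟩
  have h1 : T ⊆ convexHull ℝ (T \ {v}) := fun x hx => by
    by_cases hxv : x = v
    · rwa [hxv]
    · exact subset_convexHull ℝ _ ⟨hx, hxv⟩
  have h2 : P = convexHull ℝ (T \ {v}) :=
    hT.trans (Set.Subset.antisymm (convexHull_min h1 (convex_convexHull ℝ _))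
      (convexHull_mono Set.sdiff_subset))
  exact (hmin ⟨Set.sdiff_subset.trans hTS, h2⟩ Set.sdiff_subset hv).2 rfl

/-- An irredundant point of a generating set is an extreme point of the convex hull. -/
theorem eq_of_irredundant {T : Set E} {v x y : E} (hv : v ∈ T) (hv' : v ∉ convexHull ℝ (T \ {v}))
    (hx : x ∈ convexHull ℝ T) (hy : y ∈ convexHull ℝ T) {s t : ℝ} (hs : 0 < s) (ht : 0 < t)
    (hst : s + t = 1) (h : s • x + t • y = v) : x = v := by
  have hT : T = insert v (T \ {v}) := by simp [Set.insert_eq_of_mem hv]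
  rcases (T \ {v}).eq_empty_or_nonempty with h0 | h0
  · rw [hT, h0] at hx
    simpa using hx
  rw [hT, convexHull_insert h0] at hx hy
  simp only [convexJoin_singleton_left, Set.mem_iUnion] at hx hy
  obtain ⟨q, hq, a, b, ha, hb, hab, rfl⟩ := hx
  obtain ⟨r, hr, a', b', ha', hb', hab', rfl⟩ := hy
  have hsb := mul_nonneg hs.le hb
  have htb := mul_nonneg ht.le hb'
  rcases (add_nonneg hsb htb).eq_or_lt' with h1 | h1
  · have hb0 : b = 0 := by
      have : s * b = 0 := by linarith
      exact (mul_eq_zero.1 this).resolve_left hs.ne'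
    have ha1 : a = 1 := by linarith
    simp [hb0, ha1]
  · exfalso
    apply hv'
    -- Moving the share of `v` in `x` and `y` to the other side writes `v` as a convex combination
    -- of `q` and `r`, both in the hull without `v`.
    have e : (s * b / (s * b + t * b')) • q + (t * b' / (s * b + t * b')) • r = v := by
      have e1 : (s * b + t * b') • v = (s * b) • q + (t * b') • r := by
        have e2 : (s * b + t * b') = 1 - (s * a + t * a') := by
          linear_combination s * hab + t * hab' + hst
        rw [e2, sub_smul, one_smul]
        nth_rewrite 1 [← h]
        module
      rw [div_eq_inv_mul, div_eq_inv_mul, mul_smul _ (s * b), mul_smul _ (t * b'), ← smul_add,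
        ← e1, smul_smul, inv_mul_cancel₀ h1.ne', one_smul]
    have hm := convex_convexHull ℝ _ hq hr (div_nonneg hsb h1.le) (div_nonneg htb h1.le)
      (by rw [← add_div, div_self h1.ne'])
    rwa [e] at hm

/-- A section at level `0` would contain the whole ray through `p`, contradicting boundedness. -/
theorem IsPolytope.section_level_ne_zero {C : PointedCone ℝ E} {ξ : Module.Dual ℝ E} {c : ℝ}
    (hP : IsPolytope {x | x ∈ C ∧ ξ x = c}) {p : E} (hp : p ∈ C) (hpc : ξ p = c) (hp0 : p ≠ 0) :
    c ≠ 0 := by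
  rintro rfl
  refine hp0 (hP.eq_zero_of_add_smul_mem (p := p) (u := p) fun s hs => ⟨?_, ?_⟩)
  · exact C.add_mem hp (PointedCone.smul_mem C hs hp)
  · simp [hpc]

/-- If `ξ v ≤ 0`, then `v - ξ v • p` lies in the cone at level `0`, hence is a direction in which
the bounded section could be left; so it is zero. Then `-v` is a nonnegative multiple of `p` and
lies in `C`, against pointedness. -/
theorem IsPolytope.section_pos {C : PointedCone ℝ E} (hC : ∀ v ∈ C, -v ∈ C → v = 0)
    {ξ : Module.Dual ℝ E} (hP : IsPolytope {x | x ∈ C ∧ ξ x = 1}) {p : E} (hp : p ∈ C)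
    (hp1 : ξ p = 1) {v : E} (hv : v ∈ C) (hv0 : v ≠ 0) : 0 < ξ v := by
  by_contra! h
  have hu : v + (-ξ v) • p ∈ C := C.add_mem hv (PointedCone.smul_mem C (by linarith) hp)
  have h0 : v + (-ξ v) • p = 0 := by
    refine hP.eq_zero_of_add_smul_mem (p := p) fun s hs =>
      ⟨C.add_mem hp (PointedCone.smul_mem C hs hu), ?_⟩
    simp [hp1]
  refine hv0 (hC v hv ?_)
  rw [neg_eq_of_add_eq_zero_right h0]
  exact PointedCone.smul_mem C (by linarith) hp

/-- Rescaling the summands of `v = x + y` to level `1` makes `v` a convex combination of points of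
the section, and `v` is an extreme point there. -/
theorem IsPolytope.generatesExtremalRay {C : PointedCone ℝ E} (hC : ∀ v ∈ C, -v ∈ C → v = 0)
    {ξ : Module.Dual ℝ E} (hP : IsPolytope {x | x ∈ C ∧ ξ x = 1}) {T : Set E}
    (hT : {x | x ∈ C ∧ ξ x = 1} = convexHull ℝ T) {v : E} (hv : v ∈ T)
    (hv' : v ∉ convexHull ℝ (T \ {v})) : GeneratesExtremalRay C v := by
  have hvP : v ∈ {x | x ∈ C ∧ ξ x = 1} := by rw [hT]; exact subset_convexHull ℝ _ hv
  obtain ⟨hvC, hv1⟩ := hvP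
  refine ⟨hvC, by rintro rfl; simp at hv1, fun x hx y hy hxy => ?_⟩
  by_cases hx0 : x = 0
  · exact ⟨0, le_rfl, by simp [hx0]⟩
  by_cases hy0 : y = 0
  · exact ⟨1, zero_le_one, by simp [← hxy, hy0]⟩
  have hξx := hP.section_pos hC hvC hv1 hx hx0
  have hξy := hP.section_pos hC hvC hv1 hy hy0
  have hmem : ∀ z ∈ C, 0 < ξ z → (ξ z)⁻¹ • z ∈ convexHull ℝ T := fun z hz h => by
    rw [← hT]
    exact ⟨PointedCone.smul_mem C (inv_nonneg.2 h.le) hz, by simp [h.ne']⟩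
  have h := eq_of_irredundant hv hv' (hmem x hx hξx) (hmem y hy hξy) hξx hξy
    (by rw [← map_add, hxy, hv1]) (by simp [smul_smul, hξx.ne', hξy.ne', hxy])
  exact ⟨ξ x, hξx.le, by rw [← h, smul_smul, mul_inv_cancel₀ hξx.ne', one_smul]⟩

end Polytope

section Veronese

variable {V : Type*} [AddCommGroup V] [Module ℝ V]

/-- The exponent is odd, so any real scalar, of either sign, is absorbed into the vector as its cube
root. -/
theorem exists_tensorPow_eq_of_span_eq {v : symmetricTensors 3 V} {L : ℙ ℝ V}
    (h : Submodule.span ℝ {v} = veroneseCurve 3 L) : ∃ w, tensorPow 3 w = v := by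
  have h1 : veroneseCurve 3 L ≤ Submodule.span ℝ {tensorPow 3 L.rep} := by
    refine Submodule.span_le.2 ?_
    rintro _ ⟨u, hu, rfl⟩
    rw [Projectivization.submodule_eq] at hu
    obtain ⟨c, rfl⟩ := Submodule.mem_span_singleton.1 hu
    rw [tensorPow_smul]
    exact Submodule.smul_mem _ _ (Submodule.mem_span_singleton_self _)
  obtain ⟨a, ha⟩ := Submodule.mem_span_singleton.1
    (h1 (h ▸ Submodule.mem_span_singleton_self v))
  obtain ⟨r, rfl⟩ := exists_cube_eq a
  exact ⟨r • L.rep, by rw [tensorPow_smul, ha]⟩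

theorem IsVeronesePolytope.exists_vertices {P : Set (symmetricTensors 3 V)}
    (hP : IsVeronesePolytope 3 P) (hdim : polytopeDim P = 3) :
    ∃ (T : Set (symmetricTensors 3 V)) (w : T → V) (ξ : Module.Dual ℝ (symmetricTensors 3 V)),
      T.Finite ∧ P = convexHull ℝ T ∧ (∀ v ∈ T, v ∉ convexHull ℝ (T \ {v})) ∧
      (∀ v, tensorPow 3 (w v) = v) ∧ ∀ v ∈ T, ξ v = 1 := by
  obtain ⟨hpoly, C, hC, ξ, c, -, hPC⟩ := hP
  -- Dimension `3` prevents `P ⊆ {0}`. The nonzero point then forces a nonzero level, which is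
  -- normalised to `1`.
  obtain ⟨p, hpP, hp0⟩ : ∃ p ∈ P, p ≠ 0 := by
    by_contra! h
    have : P ⊆ {0} := h
    have h1 : vectorSpan ℝ P = ⊥ := by
      rw [eq_bot_iff, ← vectorSpan_singleton ℝ (0 : symmetricTensors 3 V)]
      exact vectorSpan_mono ℝ this
    rw [polytopeDim, h1] at hdim
    simp at hdim
  have hpP' := hpP
  rw [hPC] at hpP'
  have hc : c ≠ 0 := IsPolytope.section_level_ne_zero (hPC ▸ hpoly) hpP'.1 hpP'.2 hp0
  have hPC' : P = {x | x ∈ C ∧ (c⁻¹ • ξ) x = 1} := by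
    rw [hPC]
    ext x
    simp only [Set.mem_ofPred_eq, LinearMap.smul_apply, smul_eq_mul]
    rw [inv_mul_eq_one₀ hc, eq_comm]
  obtain ⟨T, hTf, hT, hirr⟩ := hpoly.exists_irredundant
  have hex : ∀ v : T, ∃ w, tensorPow 3 w = (v : symmetricTensors 3 V) := fun v => by
    obtain ⟨L, hL⟩ := hC.extremal v (IsPolytope.generatesExtremalRay hC.pointed (hPC' ▸ hpoly)
      (hPC' ▸ hT) v.2 (hirr v v.2))
    exact exists_tensorPow_eq_of_span_eq hL
  choose w hw using hex
  refine ⟨T, w, c⁻¹ • ξ, hTf, hT, hirr, hw, fun v hv => ?_⟩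
  have : v ∈ P := by rw [hT]; exact subset_convexHull ℝ _ hv
  rw [hPC'] at this
  exact this.2

end Veronese

/-! ### Supports of binary cubics on small configurations -/

theorem pos_mul_nonpos_and_eq_zero_iff {r x : ℝ} (hr : 0 < r) (q : Prop) :
    (r * x ≤ 0 ∧ (r * x = 0 ↔ q)) ↔ (x ≤ 0 ∧ (x = 0 ↔ q)) := by
  rw [mul_eq_zero, or_iff_right hr.ne', ← mul_zero r, mul_le_mul_iff_right₀ hr, mul_zero]

/-- Scaling a vector by `r > 0` multiplies the value of each cubic by `r ^ 3 > 0`. -/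
theorem isCubicSupport_smul_iff {ι : Type*} {w w' : ι → ℝ × ℝ} {r : ι → ℝ} (hr : ∀ i, 0 < r i)
    (h : ∀ i, w i = r i • w' i) (I : Set ι) : IsCubicSupport w I ↔ IsCubicSupport w' I := by
  refine exists_congr fun k => forall_congr' fun i => ?_
  have e : binaryCubic k (w i) = r i ^ 3 * binaryCubic k (w' i) := by
    rw [h i]; simp [binaryCubic]; ring
  rw [e]
  exact (pos_mul_nonpos_and_eq_zero_iff (pow_pos (hr i) 3) _)

/-- The simplex case: cubics take arbitrary values on four pairwise independent vectors. -/
theorem isCubicSupport_fin_four {w : Fin 4 → ℝ × ℝ}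
    (hw : ∀ i j, i ≠ j → planeDet (w i) (w j) ≠ 0) (I : Set (Fin 4)) : IsCubicSupport w I := by
  classical
  obtain ⟨k, hk⟩ := exists_binaryCubic_interpolation w hw fun i => if i ∈ I then 0 else -1
  refine ⟨k, fun i => ?_⟩
  rw [hk]
  split_ifs with h <;> simp [h]

/-- The linear relation is the only constraint on the values of a cubic at five vectors. Scaling the
values by the positive ratios `r i` turns the constraint for `w` into the one for `w'`. A relation
matters only up to sign, so opposite signs serve as well as equal ones. -/
theorem IsCubicSupport.of_cubicRelation {w w' : Fin 5 → ℝ × ℝ}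
    (hw' : ∀ i j, i ≠ j → planeDet (w' i) (w' j) ≠ 0)
    (h : ∀ i, cubicRelation w i * cubicRelation w' i < 0) {I : Set (Fin 5)}
    (hI : IsCubicSupport w I) : IsCubicSupport w' I := by
  obtain ⟨k, hk⟩ := hI
  have hne : ∀ i, cubicRelation w' i ≠ 0 := fun i h0 => by simpa [h0] using h i
  set r : Fin 5 → ℝ := fun i => -(cubicRelation w i / cubicRelation w' i) with hr
  have hr0 : ∀ i, 0 < r i := fun i => neg_pos.2 (by
    rw [← mul_div_mul_right _ _ (hne i)]
    exact div_neg_of_neg_of_pos (h i) (mul_self_pos.2 (hne i)))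
  obtain ⟨k', hk'⟩ := exists_binaryCubic_interpolation (fun i => w' i.castSucc)
    (fun i j hij => hw' _ _ fun e => hij (Fin.castSucc_injective _ e))
    fun i => r i.castSucc * binaryCubic k (w i.castSucc)
  have hall : ∀ i, binaryCubic k' (w' i) = r i * binaryCubic k (w i) := by
    refine Fin.lastCases ?_ hk'
    have e1 := sum_cubicRelation_mul w k
    have e2 := sum_cubicRelation_mul w' k'
    rw [Fin.sum_univ_castSucc] at e1 e2
    have hrr : ∀ i, cubicRelation w' i * r i = -cubicRelation w i := fun i => by
      simp only [hr]; field_simp [hne i]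
    have e3 : ∑ i : Fin 4, cubicRelation w' i.castSucc * binaryCubic k' (w' i.castSucc) =
        -∑ i : Fin 4, cubicRelation w i.castSucc * binaryCubic k (w i.castSucc) := by
      rw [← Finset.sum_neg_distrib]
      refine Finset.sum_congr rfl fun i _ => ?_
      rw [hk', ← mul_assoc, hrr]; ring
    apply mul_left_cancel₀ (hne (Fin.last 4))
    rw [← mul_assoc, hrr]
    linarith
  refine ⟨k', fun i => ?_⟩
  rw [hall]
  exact (pos_mul_nonpos_and_eq_zero_iff (hr0 i) _).2 (hk i)

/-- The vectors `a, a'`, then `b, b'`, then `c` lie in this order on three arcs, consecutive arcs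
being positively oriented. -/
structure IsArcFive (a a' b b' c : ℝ × ℝ) : Prop where
  aa : 0 < planeDet a a'
  bb : 0 < planeDet b b'
  ab : 0 < planeDet a b
  ab' : 0 < planeDet a b'
  a'b : 0 < planeDet a' b
  a'b' : 0 < planeDet a' b'
  bc : 0 < planeDet b c
  b'c : 0 < planeDet b' c
  ca : 0 < planeDet c a
  ca' : 0 < planeDet c a'

/-- In the listed order only the determinants of `a` and `a'` with `c` are negative. The resulting
Radon partition is `{a, b'}` against `{a', b, c}`. -/
theorem IsArcFive.cubicRelation_sign {a a' b b' c : ℝ × ℝ} (h : IsArcFive a a' b b' c) :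
    cubicRelation ![a, a', b, b', c] 0 < 0 ∧ 0 < cubicRelation ![a, a', b, b', c] 1 ∧
    0 < cubicRelation ![a, a', b, b', c] 2 ∧ cubicRelation ![a, a', b, b', c] 3 < 0 ∧
    0 < cubicRelation ![a, a', b, b', c] 4 := by
  obtain ⟨aa, bb, ab, ab', a'b, a'b', bc, b'c, ca, ca'⟩ := h
  have e := planeDet_swap a c
  have e' := planeDet_swap a' c
  simp only [cubicRelation, Matrix.cons_val, e, e']
  refine ⟨?_, ?_, ?_, ?_, ?_⟩
  · have : 0 < planeDet a' b * planeDet a' b' * planeDet c a' * planeDet b b' * planeDet b c *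
      planeDet b' c := by positivity
    linarith
  · have : 0 < planeDet a b * planeDet a b' * planeDet c a * planeDet b b' * planeDet b c *
      planeDet b' c := by positivity
    linarith
  · have : 0 < planeDet a a' * planeDet a b' * planeDet c a * planeDet a' b' * planeDet c a' *
      planeDet b' c := by positivity
    linarith
  · have : 0 < planeDet a a' * planeDet a b * planeDet c a * planeDet a' b * planeDet c a' *
      planeDet b c := by positivity
    linarith
  · positivity

/-- On the moment curve the signs alternate, so parameters `1, 3` oppose `0, 2, 4`. Giving `a, a'`
the parameters `1, 0` matches this with `{a, b'}` against `{a', b, c}`. -/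
theorem IsArcFive.isCubicSupport_iff {a a' b b' c : ℝ × ℝ} (h : IsArcFive a a' b b' c)
    (I : Set (Fin 5)) : IsCubicSupport ![a, a', b, b', c] I ↔
      IsCubicSupport (fun i => (1, (![1, 0, 2, 3, 4] : Fin 5 → ℝ) i)) I := by
  obtain ⟨h0, h1, h2, h3, h4⟩ := h.cubicRelation_sign
  have hs : ∀ i, cubicRelation ![a, a', b, b', c] i *
      cubicRelation (fun i => (1, (![1, 0, 2, 3, 4] : Fin 5 → ℝ) i)) i < 0 := by
    intro i
    fin_cases i
    · refine mul_neg_of_neg_of_pos h0 ?_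
      simp [cubicRelation, planeDet]; norm_num
    · refine mul_neg_of_pos_of_neg h1 ?_
      simp [cubicRelation, planeDet]; norm_num
    · refine mul_neg_of_pos_of_neg h2 ?_
      simp [cubicRelation, planeDet]; norm_num
    · refine mul_neg_of_neg_of_pos h3 ?_
      simp [cubicRelation, planeDet]; norm_num
    · refine mul_neg_of_pos_of_neg h4 ?_
      simp [cubicRelation, planeDet]; norm_num
  refine ⟨fun hI => hI.of_cubicRelation ?_ hs, fun hI => hI.of_cubicRelation ?_ fun i => ?_⟩
  · intro i j hij
    fin_cases i <;> fin_cases j <;> first | exact absurd rfl hij | norm_num [planeDet]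
  · obtain ⟨aa, bb, ab, ab', a'b, a'b', bc, b'c, ca, ca'⟩ := h
    have key : ∀ v w, 0 < planeDet v w → planeDet v w ≠ 0 ∧ planeDet w v ≠ 0 := fun v w h =>
      ⟨h.ne', by rw [planeDet_swap]; exact neg_ne_zero.2 h.ne'⟩
    intro i j hij
    fin_cases i <;> fin_cases j <;> first | exact absurd rfl hij | simp [key _ _, *]
  · rw [mul_comm]; exact hs i

/-- The vectors `a, a'`, then `b, b'`, then `c, c'` lie in this order on three arcs, consecutive
arcs being positively oriented. -/
structure IsArcSix (a a' b b' c c' : ℝ × ℝ) : Prop where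
  abc : IsArcFive a a' b b' c
  abc' : IsArcFive a a' b b' c'
  cc : 0 < planeDet c c'

theorem IsArcSix.rotate {a a' b b' c c' : ℝ × ℝ} (h : IsArcSix a a' b b' c c') :
    IsArcSix b b' c c' a a' :=
  ⟨⟨h.abc.bb, h.cc, h.abc.bc, h.abc'.bc, h.abc.b'c, h.abc'.b'c, h.abc.ca, h.abc'.ca, h.abc.ab,
    h.abc.ab'⟩, ⟨h.abc.bb, h.cc, h.abc.bc, h.abc'.bc, h.abc.b'c, h.abc'.b'c, h.abc.ca', h.abc'.ca',
    h.abc.a'b, h.abc.a'b'⟩, h.abc.aa⟩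

/-- The relation leaves a sum of nonpositive terms equal to zero. Geometrically, the segment from
`a` to `b'` crosses the triangle `a' b c`, so a face containing its ends contains all five points.
-/
theorem IsArcFive.eq_zero {a a' b b' c : ℝ × ℝ} (h : IsArcFive a a' b b' c) {k : Fin 4 → ℝ}
    (ha : binaryCubic k a = 0) (hb' : binaryCubic k b' = 0) (ha' : binaryCubic k a' ≤ 0)
    (hb : binaryCubic k b ≤ 0) (hc : binaryCubic k c ≤ 0) :
    binaryCubic k a' = 0 ∧ binaryCubic k b = 0 ∧ binaryCubic k c = 0 := by
  obtain ⟨h0, h1, h2, h3, h4⟩ := h.cubicRelation_sign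
  have e := sum_cubicRelation_mul ![a, a', b, b', c] k
  rw [Fin.sum_univ_five] at e
  simp only [Matrix.cons_val, ha, hb', mul_zero, zero_add, add_zero] at e
  have e1 := mul_nonpos_of_nonneg_of_nonpos h1.le ha'
  have e2 := mul_nonpos_of_nonneg_of_nonpos h2.le hb
  have e4 := mul_nonpos_of_nonneg_of_nonpos h4.le hc
  exact ⟨(mul_eq_zero.1 (by linarith)).resolve_left h1.ne',
    (mul_eq_zero.1 (by linarith)).resolve_left h2.ne',
    (mul_eq_zero.1 (by linarith)).resolve_left h4.ne'⟩

theorem planeDet_sub_smul (v x y : ℝ × ℝ) (α β : ℝ) :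
    planeDet v (α • x - β • y) = α * planeDet v x - β * planeDet v y := by
  simp [planeDet]; ring

theorem planeDet_self (v : ℝ × ℝ) : planeDet v v = 0 := by simp [planeDet]

theorem add_mul_pos_of_nonneg {α β x y : ℝ} (hα : 0 ≤ α) (hβ : 0 ≤ β) (h : 0 < α + β) (hx : 0 < x)
    (hy : 0 < y) : 0 < α * x + β * y := by
  rcases hα.eq_or_lt' with h0 | h0
  · subst h0
    have : 0 < β := by linarith
    simp; positivity
  · positivity

/-- Each linear factor is attached to an antipodal pair. The factor of `a, b'` has value `-β₀ det(a,
b')` at `a` and `-α₀ det(a, b')` at `b'`; the other two factors have a definite sign at both points.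
The other pairs follow by rotating the arcs. -/
theorem IsArcSix.exists_pos_mul {a a' b b' c c' : ℝ × ℝ} (h : IsArcSix a a' b b' c c')
    {α₀ β₀ α₁ β₁ α₂ β₂ : ℝ} (hα₁ : 0 ≤ α₁) (hβ₁ : 0 ≤ β₁) (h₁ : 0 < α₁ + β₁)
    (hα₂ : 0 ≤ α₂) (hβ₂ : 0 ≤ β₂) (h₂ : 0 < α₂ + β₂) :
    (∃ m > 0, planeDet a (α₀ • a - β₀ • b') * planeDet a (α₁ • b - β₁ • c') *
      planeDet a (α₂ • c - β₂ • a') = m * β₀) ∧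
    ∃ m > 0, planeDet b' (α₀ • a - β₀ • b') * planeDet b' (α₁ • b - β₁ • c') *
      planeDet b' (α₂ • c - β₂ • a') = m * α₀ := by
  simp only [planeDet_sub_smul, planeDet_self]
  obtain ⟨⟨aa, bb, ab, ab', a'b, a'b', bc, b'c, ca, ca'⟩, ⟨-, -, -, -, -, -, bc', b'c', c'a, c'a'⟩,
    cc⟩ := h
  constructor
  · refine ⟨planeDet a b' * (α₁ * planeDet a b + β₁ * planeDet c' a) *
      (α₂ * planeDet c a + β₂ * planeDet a a'), mul_pos (mul_pos ab' ?_) ?_, ?_⟩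
    · exact add_mul_pos_of_nonneg hα₁ hβ₁ h₁ ab c'a
    · exact add_mul_pos_of_nonneg hα₂ hβ₂ h₂ ca aa
    · rw [planeDet_swap a c', planeDet_swap a c]; ring
  · refine ⟨planeDet a b' * (α₁ * planeDet b b' + β₁ * planeDet b' c') *
      (α₂ * planeDet b' c + β₂ * planeDet a' b'), mul_pos (mul_pos ab' ?_) ?_, ?_⟩
    · exact add_mul_pos_of_nonneg hα₁ hβ₁ h₁ bb b'c'
    · exact add_mul_pos_of_nonneg hα₂ hβ₂ h₂ b'c a'b'
    · rw [planeDet_swap b' a, planeDet_swap b' b, planeDet_swap b' a']; ring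

/-- The proper faces of the octahedron with antipodal pairs `0, 3` and `2, 5` and `4, 1` are the
sets of vertices containing no antipodal pair. -/
def IsOctahedralSupport (I : Set (Fin 6)) : Prop :=
  I = Set.univ ∨ ¬(0 ∈ I ∧ 3 ∈ I) ∧ ¬(2 ∈ I ∧ 5 ∈ I) ∧ ¬(4 ∈ I ∧ 1 ∈ I)

theorem IsArcSix.isCubicSupport_iff {a a' b b' c c' : ℝ × ℝ} (h : IsArcSix a a' b b' c c')
    (I : Set (Fin 6)) :
    IsCubicSupport ![a, a', b, b', c, c'] I ↔ IsOctahedralSupport I := by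
  classical
  constructor
  · rintro ⟨k, hk⟩
    have H : ∀ {a a' b b' c c' : ℝ × ℝ}, IsArcSix a a' b b' c c' → binaryCubic k a ≤ 0 →
        binaryCubic k a' ≤ 0 → binaryCubic k b ≤ 0 → binaryCubic k b' ≤ 0 → binaryCubic k c ≤ 0 →
        binaryCubic k c' ≤ 0 → binaryCubic k a = 0 → binaryCubic k b' = 0 →
        binaryCubic k a' = 0 ∧ binaryCubic k b = 0 ∧ binaryCubic k c = 0 ∧
          binaryCubic k c' = 0 := fun h _ h1 h2 _ h4 h5 e e' => by
      obtain ⟨x, y, z⟩ := h.abc.eq_zero e e' h1 h2 h4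
      exact ⟨x, y, z, (h.abc'.eq_zero e e' h1 h2 h5).2.2⟩
    have k0 := hk 0
    have k1 := hk 1
    have k2 := hk 2
    have k3 := hk 3
    have k4 := hk 4
    have k5 := hk 5
    simp only [Matrix.cons_val] at k0 k1 k2 k3 k4 k5
    by_contra hI
    simp only [IsOctahedralSupport, not_or] at hI
    obtain ⟨hI, hI'⟩ := hI
    apply hI
    have all : binaryCubic k a = 0 → binaryCubic k a' = 0 → binaryCubic k b = 0 →
        binaryCubic k b' = 0 → binaryCubic k c = 0 → binaryCubic k c' = 0 → I = Set.univ := by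
      intro e0 e1 e2 e3 e4 e5
      refine Set.eq_univ_of_forall fun i => ?_
      fin_cases i
      exacts [k0.2.1 e0, k1.2.1 e1, k2.2.1 e2, k3.2.1 e3, k4.2.1 e4, k5.2.1 e5]
    rw [← k0.2, ← k1.2, ← k2.2, ← k3.2, ← k4.2, ← k5.2] at hI'
    by_cases c1 : binaryCubic k a = 0 ∧ binaryCubic k b' = 0
    · obtain ⟨e1, e2, e3, e4⟩ := H h k0.1 k1.1 k2.1 k3.1 k4.1 k5.1 c1.1 c1.2
      exact all c1.1 e1 e2 c1.2 e3 e4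
    by_cases c2 : binaryCubic k b = 0 ∧ binaryCubic k c' = 0
    · obtain ⟨e1, e2, e3, e4⟩ := H h.rotate k2.1 k3.1 k4.1 k5.1 k0.1 k1.1 c2.1 c2.2
      exact all e3 e4 c2.1 e1 e2 c2.2
    by_cases c3 : binaryCubic k c = 0 ∧ binaryCubic k a' = 0
    · obtain ⟨e1, e2, e3, e4⟩ := H h.rotate.rotate k4.1 k5.1 k0.1 k1.1 k2.1 k3.1 c3.1 c3.2
      exact all e2 c3.2 e3 e4 c3.1 e1
    exact absurd ⟨c1, c2, c3⟩ hI'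
  · rintro (rfl | ⟨h0, h1, h2⟩)
    · exact ⟨0, fun i => by simp [binaryCubic]⟩
    · set u : Fin 6 → ℝ := fun i => if i ∈ I then 0 else 1 with hu
      have hu0 : ∀ i, 0 ≤ u i := fun i => by simp only [hu]; split_ifs <;> norm_num
      have hui : ∀ i, u i = 0 ↔ i ∈ I := fun i => by simp [hu]
      have hadd : ∀ i j, ¬(j ∈ I ∧ i ∈ I) → 0 < u i + u j := fun i j hij => by
        rcases (add_nonneg (hu0 i) (hu0 j)).eq_or_lt' with e | e
        · exact absurd ⟨(hui j).1 (by linarith [hu0 i, hu0 j]),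
            (hui i).1 (by linarith [hu0 i, hu0 j])⟩ hij
        · exact e
      -- The cross-over of the weights makes the value at each vertex `i` a positive multiple of `u
      -- i`. Each linear factor is nonzero because no antipodal pair lies in `I`; the sign is
      -- reversed at the end.
      obtain ⟨k, hk⟩ := exists_binaryCubic_eq_planeDet_mul (u 3 • a - u 0 • b')
        (u 5 • b - u 2 • c') (u 1 • c - u 4 • a')
      have p0 := hadd _ _ h0
      have p1 := hadd _ _ h1
      have p2 := hadd _ _ h2
      have fin : ∀ v i, (∃ m > 0, binaryCubic k v = m * u i) →
          binaryCubic (-1 • k) v ≤ 0 ∧ (binaryCubic (-1 • k) v = 0 ↔ i ∈ I) := by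
        rintro v i ⟨m, hm, e⟩
        rw [← hui, neg_one_smul ℤ k, ← neg_one_smul ℝ k, binaryCubic_smul, e]
        have := mul_nonneg hm.le (hu0 i)
        refine ⟨by linarith, ?_⟩
        simp [hm.ne']
      obtain ⟨q0, q3⟩ := h.exists_pos_mul (α₀ := u 3) (β₀ := u 0) (hu0 5) (hu0 2) p1
        (hu0 1) (hu0 4) p2
      obtain ⟨q2, q5⟩ := h.rotate.exists_pos_mul (α₀ := u 5) (β₀ := u 2) (hu0 1) (hu0 4) p2
        (hu0 3) (hu0 0) p0
      obtain ⟨q4, q1⟩ := h.rotate.rotate.exists_pos_mul (α₀ := u 1) (β₀ := u 4) (hu0 3) (hu0 0) p0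
        (hu0 5) (hu0 2) p1
      have hk1 : ∀ v, binaryCubic k v = planeDet v (u 5 • b - u 2 • c') *
          planeDet v (u 1 • c - u 4 • a') * planeDet v (u 3 • a - u 0 • b') := fun v => by
        rw [hk]; ring
      have hk2 : ∀ v, binaryCubic k v = planeDet v (u 1 • c - u 4 • a') *
          planeDet v (u 3 • a - u 0 • b') * planeDet v (u 5 • b - u 2 • c') := fun v => by
        rw [hk]; ring
      refine ⟨-1 • k, fun i => ?_⟩
      fin_cases i
      · exact fin a 0 (by rw [hk]; exact q0)
      · exact fin a' 1 (by rw [hk2]; exact q1)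
      · exact fin b 2 (by rw [hk1]; exact q2)
      · exact fin b' 3 (by rw [hk]; exact q3)
      · exact fin c 4 (by rw [hk2]; exact q4)
      · exact fin c' 5 (by rw [hk1]; exact q5)

/-- The vertices of the octahedron. -/
def octahedronVertex : Fin 6 → Fin 3 → ℝ :=
  ![Pi.single 0 1, -Pi.single 2 1, Pi.single 1 1, -Pi.single 0 1, Pi.single 2 1, -Pi.single 1 1]

theorem convexHull_range_octahedronVertex :
    convexHull ℝ (Set.range octahedronVertex) = crossPolytope 3 := by
  rw [crossPolytope]
  congr 1
  ext x
  constructor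
  · rintro ⟨i, rfl⟩
    fin_cases i
    exacts [⟨0, Or.inl rfl⟩, ⟨2, Or.inr rfl⟩, ⟨1, Or.inl rfl⟩, ⟨0, Or.inr rfl⟩, ⟨2, Or.inl rfl⟩,
      ⟨1, Or.inr rfl⟩]
  · rintro ⟨i, rfl | rfl⟩
    · fin_cases i
      exacts [⟨0, rfl⟩, ⟨2, rfl⟩, ⟨4, rfl⟩]
    · fin_cases i
      exacts [⟨3, rfl⟩, ⟨5, rfl⟩, ⟨1, rfl⟩]

theorem isFaceSupport_octahedronVertex_iff (I : Set (Fin 6)) :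
    IsFaceSupport octahedronVertex I ↔ IsOctahedralSupport I := by
  classical
  constructor
  · rintro ⟨f, c, hf⟩
    have k0 := hf 0
    have k1 := hf 1
    have k2 := hf 2
    have k3 := hf 3
    have k4 := hf 4
    have k5 := hf 5
    simp only [octahedronVertex, Matrix.cons_val, map_neg] at k0 k1 k2 k3 k4 k5
    by_contra hI
    simp only [IsOctahedralSupport, not_or] at hI
    obtain ⟨hI, hI'⟩ := hI
    apply hI
    rw [← k0.2, ← k1.2, ← k2.2, ← k3.2, ← k4.2, ← k5.2] at hI'
    -- A functional takes opposite values at antipodal vertices, so tightness at both gives `c = 0`,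
    -- and then every inequality is tight.
    have hc : c = 0 := by
      by_contra hc
      refine hI' ⟨?_, ?_, ?_⟩ <;> rintro ⟨e, e'⟩ <;> apply hc <;> linarith
    subst hc
    refine Set.eq_univ_of_forall fun i => ?_
    fin_cases i
    exacts [k0.2.1 (by linarith), k1.2.1 (by linarith), k2.2.1 (by linarith), k3.2.1 (by linarith),
      k4.2.1 (by linarith), k5.2.1 (by linarith)]
  · rintro (rfl | ⟨h0, h1, h2⟩)
    · exact ⟨0, 0, fun i => by simp⟩
    · set u : Fin 6 → ℝ := fun i => if i ∈ I then 1 else 0 with hu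
      let f : Module.Dual ℝ (Fin 3 → ℝ) := (u 0 - u 3) • LinearMap.proj 0 +
        (u 2 - u 5) • LinearMap.proj 1 + (u 4 - u 1) • LinearMap.proj 2
      refine ⟨f, 1, fun i => ?_⟩
      have key : ∀ i j, ¬(i ∈ I ∧ j ∈ I) → (u i - u j ≤ 1 ∧ (u i - u j = 1 ↔ i ∈ I)) ∧
          (-(u i - u j) ≤ 1 ∧ (-(u i - u j) = 1 ↔ j ∈ I)) := by
        intro i j hij
        by_cases hi : i ∈ I <;> by_cases hj : j ∈ I
        · exact absurd ⟨hi, hj⟩ hij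
        · norm_num [hu, hi, hj]
        · norm_num [hu, hi, hj]
        · norm_num [hu, hi, hj]
      obtain ⟨q0, q3⟩ := key _ _ h0
      obtain ⟨q2, q5⟩ := key _ _ h1
      obtain ⟨q4, q1⟩ := key _ _ h2
      fin_cases i
      · simpa [f, octahedronVertex] using q0
      · simpa [f, octahedronVertex] using q1
      · simpa [f, octahedronVertex] using q2
      · simpa [f, octahedronVertex] using q3
      · simpa [f, octahedronVertex] using q4
      · simpa [f, octahedronVertex] using q5

/-! ### Veronese configurations -/

section Configuration

theorem isCyclicPolytope_of_isCubicSupport {ι E : Type*} [Fintype ι] [AddCommGroup E] [Module ℝ E]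
    {p : ι → E} {t : ι → ℝ} (ht : Function.Injective t) (hι : 4 ≤ Fintype.card ι)
    (h : ∀ I, IsFaceSupport p I ↔ IsCubicSupport (fun i => (1, t i)) I) :
    IsCyclicPolytope 3 (convexHull ℝ (Set.range p)) := by
  classical
  refine ⟨⟨_, Set.finite_range p, rfl⟩, Finset.univ.image t, ?_, ?_⟩
  · rwa [Finset.card_image_of_injective _ ht, Finset.card_univ]
  · have e : momentCurve 3 '' ((Finset.univ.image t : Finset ℝ) : Set ℝ) =
        Set.range fun i => momentCurve 3 (t i) := by
      rw [Finset.coe_image, Finset.coe_univ, Set.image_univ, ← Set.range_comp]; rfl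
    rw [e]
    exact combinatoriallyEquivalent_of_isFaceSupport_iff fun I =>
      (h I).trans (isFaceSupport_momentCurve_iff t I).symm

theorem exists_planeEquiv {α β γ δ : ℝ} (h : α * δ - β * γ ≠ 0) :
    ∃ M : (ℝ × ℝ) ≃ₗ[ℝ] ℝ × ℝ, ∀ w, M w = (α * w.1 + β * w.2, γ * w.1 + δ * w.2) := by
  let f : (ℝ × ℝ) →ₗ[ℝ] ℝ × ℝ :=
    { toFun := fun w => (α * w.1 + β * w.2, γ * w.1 + δ * w.2)
      map_add' := fun v w => by ext <;> simp <;> ring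
      map_smul' := fun c w => by ext <;> simp <;> ring }
  have hf : Function.Injective f := by
    rw [injective_iff_map_eq_zero]
    intro w hw
    have h1 : α * w.1 + β * w.2 = 0 := congrArg Prod.fst hw
    have h2 : γ * w.1 + δ * w.2 = 0 := congrArg Prod.snd hw
    ext
    · exact (mul_eq_zero.1 (by linear_combination δ * h1 - β * h2 :
        (α * δ - β * γ) * w.1 = 0)).resolve_left h
    · exact (mul_eq_zero.1 (by linear_combination α * h2 - γ * h1 :
        (α * δ - β * γ) * w.2 = 0)).resolve_left h
  exact ⟨LinearEquiv.ofInjectiveEndo f hf, fun w => rfl⟩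

theorem exists_smul_eq_of_planeDet_eq_zero {v w : ℝ × ℝ} (hv : v ≠ 0) (h : planeDet v w = 0) :
    ∃ c : ℝ, w = c • v := by
  rw [planeDet] at h
  by_cases h1 : v.1 = 0
  · have h2 : v.2 ≠ 0 := fun h2 => hv (Prod.ext h1 h2)
    have h3 : w.1 = 0 := by simpa [h1, h2] using h
    exact ⟨w.2 / v.2, Prod.ext (by simp [h1, h3]) (by simp [h2])⟩
  · refine ⟨w.1 / v.1, Prod.ext (by simp [h1]) ?_⟩
    simp; field_simp; linarith

variable {V : Type*} [AddCommGroup V] [Module ℝ V]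

/-- If `w = c • v`, the common level gives `c ^ 3 = 1`. Distinct vertices therefore come from
linearly independent vectors. -/
theorem tensorPow_eq_of_planeDet_eq_zero (e : V ≃ₗ[ℝ] ℝ × ℝ)
    {ξ : Module.Dual ℝ (symmetricTensors 3 V)} {v w : V} (hv : ξ (tensorPow 3 v) = 1)
    (hw : ξ (tensorPow 3 w) = 1) (h : planeDet (e v) (e w) = 0) :
    tensorPow 3 v = tensorPow 3 w := by
  have hv0 : e v ≠ 0 := fun h0 => by
    have : v = (0 : ℝ) • v := by rw [e.map_eq_zero_iff.1 h0, smul_zero]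
    rw [this, tensorPow_smul] at hv
    simp at hv
  obtain ⟨c, hc⟩ := exists_smul_eq_of_planeDet_eq_zero hv0 h
  have hwv : w = c • v := e.injective (by rw [hc, map_smul])
  rw [hwv, tensorPow_smul, map_smul, hv, smul_eq_mul, mul_one] at hw
  rw [hwv, tensorPow_smul, hw, one_smul]

theorem sum_cubicRelation_smul_tensorPow (e : V ≃ₗ[ℝ] ℝ × ℝ) (w : Fin 5 → V) :
    ∑ i, cubicRelation (fun i => e (w i)) i • tensorPow 3 (w i) = 0 := by
  rw [← Module.forall_dual_apply_eq_zero_iff ℝ]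
  intro f
  obtain ⟨k, hk⟩ := exists_binaryCubic_eq_dual e f
  simp only [map_sum, map_smul, hk, smul_eq_mul]
  exact sum_cubicRelation_mul _ k

/-- If the only negative coefficient of an affine relation is that of `p j`, then `p j` is a convex
combination of the other points. -/
theorem mem_convexHull_of_relation {ι E : Type*} [Fintype ι] [AddCommGroup E] [Module ℝ E]
    {p : ι → E} {l : ι → ℝ} {ξ : Module.Dual ℝ E} (hξ : ∀ i, ξ (p i) = 1)
    (h : ∑ i, l i • p i = 0) {j : ι} (hj : l j < 0) (hl : ∀ i, i ≠ j → 0 ≤ l i) :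
    p j ∈ convexHull ℝ (p '' {j}ᶜ) := by
  classical
  -- Applying `ξ` shows that the linear relation is affine.
  have h1 : ∑ i, l i = 0 := by simpa [hξ] using congrArg ξ h
  rw [← Finset.add_sum_erase _ _ (Finset.mem_univ j)] at h h1
  have e : p j = ∑ i ∈ Finset.univ.erase j, (l i / -l j) • p i := by
    have : (-l j) • p j = ∑ i ∈ Finset.univ.erase j, l i • p i := by
      rw [neg_smul]; exact neg_eq_of_add_eq_zero_right h
    simp only [div_eq_inv_mul, mul_smul]
    rw [← Finset.smul_sum, ← this, smul_smul, inv_mul_cancel₀ (neg_ne_zero.2 hj.ne), one_smul]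
  have hmem := (convex_convexHull ℝ (p '' {j}ᶜ)).sum_mem (t := Finset.univ.erase j)
    (w := fun i => l i / -l j) (z := p)
    (fun i hi => div_nonneg (hl i (Finset.ne_of_mem_erase hi)) (by linarith))
    (by rw [← Finset.sum_div, div_eq_one_iff_eq (by linarith)]; linarith)
    (fun i hi => subset_convexHull ℝ _ ⟨i, Finset.ne_of_mem_erase hi, rfl⟩)
  rwa [← e] at hmem

/-- If three points lie on one arc and the two other arcs are occupied, then the middle one is
redundant. -/
theorem tensorPow_mem_convexHull_of_three_on_arc (e : V ≃ₗ[ℝ] ℝ × ℝ)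
    {ξ : Module.Dual ℝ (symmetricTensors 3 V)} {w : Fin 5 → V}
    (hξ : ∀ i, ξ (tensorPow 3 (w i)) = 1)
    (h01 : 0 < planeDet (e (w 0)) (e (w 1))) (h02 : 0 < planeDet (e (w 0)) (e (w 2)))
    (h12 : 0 < planeDet (e (w 1)) (e (w 2))) (h03 : 0 < planeDet (e (w 0)) (e (w 3)))
    (h13 : 0 < planeDet (e (w 1)) (e (w 3))) (h23 : 0 < planeDet (e (w 2)) (e (w 3)))
    (h34 : 0 < planeDet (e (w 3)) (e (w 4))) (h40 : 0 < planeDet (e (w 4)) (e (w 0)))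
    (h41 : 0 < planeDet (e (w 4)) (e (w 1))) (h42 : 0 < planeDet (e (w 4)) (e (w 2))) :
    tensorPow 3 (w 1) ∈ convexHull ℝ ((fun i => tensorPow 3 (w i)) '' {1}ᶜ) := by
  -- The last vector precedes the first three cyclically. After these three sign changes the
  -- relation has signs `+, -, +, +, +`.
  have e0 := planeDet_swap (e (w 0)) (e (w 4))
  have e1 := planeDet_swap (e (w 1)) (e (w 4))
  have e2 := planeDet_swap (e (w 2)) (e (w 4))
  refine mem_convexHull_of_relation (p := fun i => tensorPow 3 (w i)) hξ
    (sum_cubicRelation_smul_tensorPow e w) (j := 1) ?_ fun i hi => ?_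
  · simp only [cubicRelation, Matrix.cons_val, e0, e1, e2]
    have : 0 < planeDet (e (w 0)) (e (w 2)) * planeDet (e (w 0)) (e (w 3)) *
      planeDet (e (w 4)) (e (w 0)) * planeDet (e (w 2)) (e (w 3)) * planeDet (e (w 4)) (e (w 2)) *
      planeDet (e (w 3)) (e (w 4)) := by positivity
    linarith
  · fin_cases i
    · simp only [cubicRelation, Fin.mk_zero, Matrix.cons_val, e0, e1, e2]
      have : 0 < planeDet (e (w 1)) (e (w 2)) * planeDet (e (w 1)) (e (w 3)) *
        planeDet (e (w 4)) (e (w 1)) * planeDet (e (w 2)) (e (w 3)) *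
        planeDet (e (w 4)) (e (w 2)) * planeDet (e (w 3)) (e (w 4)) := by positivity
      linarith
    · exact absurd rfl hi
    · simp only [cubicRelation, Fin.reduceFinMk, Matrix.cons_val, e0, e1, e2]
      have : 0 < planeDet (e (w 0)) (e (w 1)) * planeDet (e (w 0)) (e (w 3)) *
        planeDet (e (w 4)) (e (w 0)) * planeDet (e (w 1)) (e (w 3)) *
        planeDet (e (w 4)) (e (w 1)) * planeDet (e (w 3)) (e (w 4)) := by positivity
      linarith
    · simp only [cubicRelation, Fin.reduceFinMk, Matrix.cons_val, e0, e1, e2]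
      have : 0 < planeDet (e (w 0)) (e (w 1)) * planeDet (e (w 0)) (e (w 2)) *
        planeDet (e (w 4)) (e (w 0)) * planeDet (e (w 1)) (e (w 2)) *
        planeDet (e (w 4)) (e (w 1)) * planeDet (e (w 4)) (e (w 2)) := by positivity
      linarith
    · simp only [cubicRelation, Fin.reduceFinMk, Matrix.cons_val]
      positivity

/-- A configuration of points of the twisted cubic in the affine hyperplane `ξ = 1`, in convex
position. -/
structure IsVeroneseConfiguration {ι : Type*} (w : ι → V)
    (ξ : Module.Dual ℝ (symmetricTensors 3 V)) : Prop where
  level : ∀ i, ξ (tensorPow 3 (w i)) = 1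
  injective : Function.Injective fun i => tensorPow 3 (w i)
  irredundant : ∀ i, tensorPow 3 (w i) ∉ convexHull ℝ ((fun i => tensorPow 3 (w i)) '' {i}ᶜ)

variable {ι : Type*} {w : ι → V} {ξ : Module.Dual ℝ (symmetricTensors 3 V)}

theorem IsVeroneseConfiguration.planeDet_ne_zero (h : IsVeroneseConfiguration w ξ)
    (e : V ≃ₗ[ℝ] ℝ × ℝ) {i j : ι} (hij : i ≠ j) : planeDet (e (w i)) (e (w j)) ≠ 0 := fun h0 =>
  hij (h.injective (tensorPow_eq_of_planeDet_eq_zero e (h.level i) (h.level j) h0))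

theorem IsVeroneseConfiguration.isCyclicPolytope_of_halfPlane [Fintype ι]
    (h : IsVeroneseConfiguration w ξ) (hι : 4 ≤ Fintype.card ι) (e : V ≃ₗ[ℝ] ℝ × ℝ) (α β : ℝ)
    (hpos : ∀ i, 0 < α * (e (w i)).1 + β * (e (w i)).2) :
    IsCyclicPolytope 3 (convexHull ℝ (Set.range fun i => tensorPow 3 (w i))) := by
  -- The matrix with rows `(α, β)` and `(-β, α)` is a scaled rotation whose first coordinate is the
  -- positive form; the slope then serves as the parameter `t`.
  have hαβ : α * α - β * -β ≠ 0 := by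
    intro h0
    have hα : α = 0 := by nlinarith [sq_nonneg β, sq_nonneg α]
    have hβ : β = 0 := by nlinarith [sq_nonneg β, sq_nonneg α]
    obtain ⟨i⟩ : Nonempty ι := Fintype.card_pos_iff.1 (by omega)
    simpa [hα, hβ] using hpos i
  obtain ⟨M, hM⟩ := exists_planeEquiv hαβ
  set e' := e.trans M with he'
  have hpos' : ∀ i, 0 < (e' (w i)).1 := fun i => by
    simpa [he', hM] using hpos i
  refine isCyclicPolytope_of_isCubicSupport (t := fun i => (e' (w i)).2 / (e' (w i)).1) ?_ hι
    fun I => (isFaceSupport_tensorPow_iff e' h.level I).trans (isCubicSupport_smul_iff hpos'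
      (fun i => ?_) I)
  · intro i j hij
    by_contra hne
    apply h.planeDet_ne_zero e' hne
    have := (div_eq_div_iff (hpos' i).ne' (hpos' j).ne').1 hij
    rw [planeDet]
    linarith
  · have := (hpos' i).ne'
    ext
    · simp
    · simp; field_simp

/-- On an arc the determinant orders the vectors by a slope `t`. Any point besides those of least
and greatest slope would be the middle of a forbidden triple. The case `i = j` is an arc with one
point. -/
theorem exists_eq_pair_of_no_triple [Finite ι] {S : Set ι} (hS : S.Nonempty) {d : ι → ι → ℝ}
    {r t : ι → ℝ} (hr : ∀ i ∈ S, 0 < r i)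
    (hd : ∀ i ∈ S, ∀ j ∈ S, d i j = r i * r j * (t j - t i))
    (hne : ∀ i j, i ≠ j → d i j ≠ 0)
    (h : ∀ i ∈ S, ∀ j ∈ S, ∀ k ∈ S, 0 < d i j → 0 < d i k → 0 < d j k → False) :
    ∃ i ∈ S, ∃ j ∈ S, (∀ k ∈ S, k = i ∨ k = j) ∧ (i = j ∨ 0 < d i j) := by
  obtain ⟨i, hi, himin⟩ := Set.exists_min_image S t S.toFinite hS
  obtain ⟨j, hj, hjmax⟩ := Set.exists_max_image S t S.toFinite hS
  have pos : ∀ i ∈ S, ∀ j ∈ S, i ≠ j → t i ≤ t j → 0 < d i j := fun i hi j hj hij hle => by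
    refine lt_of_le_of_ne ?_ (hne i j hij).symm
    rw [hd i hi j hj]
    exact mul_nonneg (mul_nonneg (hr i hi).le (hr j hj).le) (sub_nonneg.2 hle)
  refine ⟨i, hi, j, hj, fun k hk => ?_, ?_⟩
  · by_contra! hc
    have hij : i ≠ j := by
      rintro rfl
      have h1 : t k - t i = 0 := by linarith [himin k hk, hjmax k hk]
      exact hne i k hc.1.symm (by rw [hd i hi k hk, h1, mul_zero])
    exact h i hi k hk j hj (pos i hi k hk hc.1.symm (himin k hk))
      (pos i hi j hj hij (himin j hj)) (pos k hk j hj hc.2 (hjmax k hk))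
  · by_cases hij : i = j
    · exact Or.inl hij
    · exact Or.inr (pos i hi j hj hij (himin j hj))

theorem IsVeroneseConfiguration.not_three_on_arc (h : IsVeroneseConfiguration w ξ)
    (e : V ≃ₗ[ℝ] ℝ × ℝ) {S S' S'' : Set ι}
    (h1 : ∀ i ∈ S, ∀ j ∈ S', 0 < planeDet (e (w i)) (e (w j)))
    (h2 : ∀ i ∈ S', ∀ j ∈ S'', 0 < planeDet (e (w i)) (e (w j)))
    (h3 : ∀ i ∈ S'', ∀ j ∈ S, 0 < planeDet (e (w i)) (e (w j)))
    (hS' : S'.Nonempty) (hS'' : S''.Nonempty) {i j k : ι} (hi : i ∈ S) (hj : j ∈ S) (hk : k ∈ S)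
    (hij : 0 < planeDet (e (w i)) (e (w j))) (hik : 0 < planeDet (e (w i)) (e (w k)))
    (hjk : 0 < planeDet (e (w j)) (e (w k))) : False := by
  obtain ⟨l, hl⟩ := hS'
  obtain ⟨m, hm⟩ := hS''
  have hne : ∀ a b, 0 < planeDet (e (w a)) (e (w b)) → a ≠ b := by
    rintro a _ h rfl
    simp [planeDet_self] at h
  refine h.irredundant j (convexHull_mono ?_ (tensorPow_mem_convexHull_of_three_on_arc e (ξ := ξ)
    (w := fun a => w (![i, j, k, l, m] a)) (fun a => h.level _) hij hik hjk (h1 i hi l hl)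
    (h1 j hj l hl) (h1 k hk l hl) (h2 l hl m hm) (h3 m hm i hi) (h3 m hm j hj) (h3 m hm k hk)))
  rintro _ ⟨a, ha, rfl⟩
  refine ⟨![i, j, k, l, m] a, ?_, rfl⟩
  rw [Set.mem_compl_singleton_iff]
  fin_cases a
  · exact hne _ _ hij
  · exact absurd rfl ha
  · exact (hne _ _ hjk).symm
  · exact (hne _ _ (h1 j hj l hl)).symm
  · exact hne _ _ (h3 m hm j hj)

theorem range_comp_of_surjective {κ E : Type*} {σ : κ → ι} (hσ : Function.Surjective σ)
    (p : ι → E) : Set.range p = Set.range fun a => p (σ a) :=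
  (hσ.range_comp p).symm

theorem IsVeroneseConfiguration.isCyclicPolytope_of_card_four [Fintype ι]
    (h : IsVeroneseConfiguration w ξ) (e : V ≃ₗ[ℝ] ℝ × ℝ) (hι : Fintype.card ι = 4) :
    IsCyclicPolytope 3 (convexHull ℝ (Set.range fun i => tensorPow 3 (w i))) := by
  let σ := (Fintype.equivFinOfCardEq hι).symm
  rw [range_comp_of_surjective σ.surjective]
  refine isCyclicPolytope_of_isCubicSupport (t := fun i : Fin 4 => ((i : ℕ) : ℝ))
    (fun i j hij => Fin.ext (Nat.cast_injective hij)) (by simp) fun I => ?_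
  rw [isFaceSupport_tensorPow_iff e (fun i => h.level _)]
  refine iff_of_true (isCubicSupport_fin_four (fun i j hij => ?_) I)
    (isCubicSupport_fin_four (fun i j hij => ?_) I)
  · exact h.planeDet_ne_zero e (σ.injective.ne hij)
  · have : ((i : ℕ) : ℝ) ≠ ((j : ℕ) : ℝ) := fun h0 => hij (Fin.ext (Nat.cast_injective h0))
    simp only [planeDet, one_mul]
    exact sub_ne_zero.2 this.symm

theorem isCyclicPolytope_of_isArcFive (e : V ≃ₗ[ℝ] ℝ × ℝ)
    (hξ : ∀ i, ξ (tensorPow 3 (w i)) = 1) {a a' b b' c : ι}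
    (hs : ∀ i, i = a ∨ i = a' ∨ i = b ∨ i = b' ∨ i = c)
    (h : IsArcFive (e (w a)) (e (w a')) (e (w b)) (e (w b')) (e (w c))) :
    IsCyclicPolytope 3 (convexHull ℝ (Set.range fun i => tensorPow 3 (w i))) := by
  have hσ : Function.Surjective ![a, a', b, b', c] := by
    intro i
    rcases hs i with rfl | rfl | rfl | rfl | rfl
    exacts [⟨0, rfl⟩, ⟨1, rfl⟩, ⟨2, rfl⟩, ⟨3, rfl⟩, ⟨4, rfl⟩]
  rw [range_comp_of_surjective hσ]
  refine isCyclicPolytope_of_isCubicSupport (t := ![1, 0, 2, 3, 4]) ?_ (by simp) fun I => ?_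
  · intro i j hij
    fin_cases i <;> fin_cases j <;> first | rfl | norm_num at hij
  · rw [isFaceSupport_tensorPow_iff e (fun i => hξ _), ← h.isCubicSupport_iff]
    have : (fun i => e (w (![a, a', b, b', c] i))) =
        ![e (w a), e (w a'), e (w b), e (w b'), e (w c)] := by
      ext i <;> fin_cases i <;> rfl
    rw [this]

theorem combinatoriallyEquivalent_crossPolytope_of_isArcSix (e : V ≃ₗ[ℝ] ℝ × ℝ)
    (hξ : ∀ i, ξ (tensorPow 3 (w i)) = 1) {a a' b b' c c' : ι}
    (hs : ∀ i, i = a ∨ i = a' ∨ i = b ∨ i = b' ∨ i = c ∨ i = c')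
    (h : IsArcSix (e (w a)) (e (w a')) (e (w b)) (e (w b')) (e (w c)) (e (w c'))) :
    CombinatoriallyEquivalent (convexHull ℝ (Set.range fun i => tensorPow 3 (w i)))
      (crossPolytope 3) := by
  have hσ : Function.Surjective ![a, a', b, b', c, c'] := by
    intro i
    rcases hs i with rfl | rfl | rfl | rfl | rfl | rfl
    exacts [⟨0, rfl⟩, ⟨1, rfl⟩, ⟨2, rfl⟩, ⟨3, rfl⟩, ⟨4, rfl⟩, ⟨5, rfl⟩]
  rw [range_comp_of_surjective hσ, ← convexHull_range_octahedronVertex]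
  refine combinatoriallyEquivalent_of_isFaceSupport_iff fun I => ?_
  rw [isFaceSupport_tensorPow_iff e (fun i => hξ _), isFaceSupport_octahedronVertex_iff,
    ← h.isCubicSupport_iff]
  have : (fun i => e (w (![a, a', b, b', c, c'] i))) =
      ![e (w a), e (w a'), e (w b), e (w b'), e (w c), e (w c')] := by
    ext i <;> fin_cases i <;> rfl
  rw [this]

theorem card_le_of_forall_mem [Fintype ι] (l : List ι) (h : ∀ i, i ∈ l) :
    Fintype.card ι ≤ l.length := by
  classical
  calc Fintype.card ι = (Finset.univ : Finset ι).card := rfl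
    _ ≤ l.toFinset.card := Finset.card_le_card fun i _ => List.mem_toFinset.2 (h i)
    _ ≤ l.length := l.toFinset_card_le

end Configuration

section Classification

variable {V ι : Type*} [AddCommGroup V] [Module ℝ V] {w : ι → V}
  {ξ : Module.Dual ℝ (symmetricTensors 3 V)}

/-- A Veronese configuration on three occupied arcs has one or two points on each arc. -/
theorem IsVeroneseConfiguration.cyclic_or_octahedron_of_arcs [Fintype ι]
    (h : IsVeroneseConfiguration w ξ) (hι : 4 ≤ Fintype.card ι) (e : V ≃ₗ[ℝ] ℝ × ℝ)
    {S S' S'' : Set ι} (hcover : ∀ i, i ∈ S ∨ i ∈ S' ∨ i ∈ S'')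
    (h1 : ∀ i ∈ S, ∀ j ∈ S', 0 < planeDet (e (w i)) (e (w j)))
    (h2 : ∀ i ∈ S', ∀ j ∈ S'', 0 < planeDet (e (w i)) (e (w j)))
    (h3 : ∀ i ∈ S'', ∀ j ∈ S, 0 < planeDet (e (w i)) (e (w j)))
    (hS : ∃ i ∈ S, ∃ j ∈ S, (∀ k ∈ S, k = i ∨ k = j) ∧ (i = j ∨ 0 < planeDet (e (w i)) (e (w j))))
    (hS' : ∃ i ∈ S', ∃ j ∈ S', (∀ k ∈ S', k = i ∨ k = j) ∧
      (i = j ∨ 0 < planeDet (e (w i)) (e (w j))))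
    (hS'' : ∃ i ∈ S'', ∃ j ∈ S'', (∀ k ∈ S'', k = i ∨ k = j) ∧
      (i = j ∨ 0 < planeDet (e (w i)) (e (w j)))) :
    IsCyclicPolytope 3 (convexHull ℝ (Set.range fun i => tensorPow 3 (w i))) ∨
    CombinatoriallyEquivalent (convexHull ℝ (Set.range fun i => tensorPow 3 (w i)))
      (crossPolytope 3) := by
  obtain ⟨a, ha, a', ha', hSa, haa⟩ := hS
  obtain ⟨b, hb, b', hb', hSb, hbb⟩ := hS'
  obtain ⟨c, hc, c', hc', hSc, hcc⟩ := hS''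
  have hall : ∀ i, i = a ∨ i = a' ∨ i = b ∨ i = b' ∨ i = c ∨ i = c' := fun i => by
    rcases hcover i with hi | hi | hi
    · have := hSa i hi; tauto
    · have := hSb i hi; tauto
    · have := hSc i hi; tauto
  have four : ∀ x y z t : ι, (∀ i, i = x ∨ i = y ∨ i = z ∨ i = t) →
      IsCyclicPolytope 3 (convexHull ℝ (Set.range fun i => tensorPow 3 (w i))) :=
    fun x y z t hx => h.isCyclicPolytope_of_card_four e
      (le_antisymm (card_le_of_forall_mem [x, y, z, t] fun i => by simpa using hx i) hι)
  rcases haa with rfl | haa <;> rcases hbb with rfl | hbb <;> rcases hcc with rfl | hcc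
  · exact Or.inl (four a b c c fun i => by have := hall i; tauto)
  · exact Or.inl (four a b c c' fun i => by have := hall i; tauto)
  · exact Or.inl (four a b b' c fun i => by have := hall i; tauto)
  -- With five vertices the arcs are relabelled cyclically so that the arc with a single point comes
  -- last.
  · exact Or.inl (isCyclicPolytope_of_isArcFive e h.level (a := b) (a' := b') (b := c) (b' := c')
      (c := a) (fun i => by have := hall i; tauto)
      ⟨hbb, hcc, h2 _ hb _ hc, h2 _ hb _ hc', h2 _ hb' _ hc, h2 _ hb' _ hc', h3 _ hc _ ha,
        h3 _ hc' _ ha, h1 _ ha _ hb, h1 _ ha _ hb'⟩)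
  · exact Or.inl (four a a' b c fun i => by have := hall i; tauto)
  · exact Or.inl (isCyclicPolytope_of_isArcFive e h.level (a := c) (a' := c') (b := a) (b' := a')
      (c := b) (fun i => by have := hall i; tauto)
      ⟨hcc, haa, h3 _ hc _ ha, h3 _ hc _ ha', h3 _ hc' _ ha, h3 _ hc' _ ha', h1 _ ha _ hb,
        h1 _ ha' _ hb, h2 _ hb _ hc, h2 _ hb _ hc'⟩)
  · exact Or.inl (isCyclicPolytope_of_isArcFive e h.level (a := a) (a' := a') (b := b) (b' := b')
      (c := c) (fun i => by have := hall i; tauto)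
      ⟨haa, hbb, h1 _ ha _ hb, h1 _ ha _ hb', h1 _ ha' _ hb, h1 _ ha' _ hb', h2 _ hb _ hc,
        h2 _ hb' _ hc, h3 _ hc _ ha, h3 _ hc _ ha'⟩)
  · have arc : ∀ x ∈ S'', IsArcFive (e (w a)) (e (w a')) (e (w b)) (e (w b')) (e (w x)) :=
      fun x hx => ⟨haa, hbb, h1 _ ha _ hb, h1 _ ha _ hb', h1 _ ha' _ hb, h1 _ ha' _ hb',
        h2 _ hb _ hx, h2 _ hb' _ hx, h3 _ hx _ ha, h3 _ hx _ ha'⟩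
    exact Or.inr (combinatoriallyEquivalent_crossPolytope_of_isArcSix e h.level hall
      ⟨arc c hc, arc c' hc', hcc⟩)

theorem IsVeroneseConfiguration.cyclic_or_octahedron [Fintype ι]
    (h : IsVeroneseConfiguration w ξ) (hι : 4 ≤ Fintype.card ι) (e₀ : V ≃ₗ[ℝ] ℝ × ℝ) :
    IsCyclicPolytope 3 (convexHull ℝ (Set.range fun i => tensorPow 3 (w i))) ∨
    CombinatoriallyEquivalent (convexHull ℝ (Set.range fun i => tensorPow 3 (w i)))
      (crossPolytope 3) := by
  obtain ⟨k, hk⟩ := exists_binaryCubic_eq_dual e₀ ξ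
  rcases binaryCubic_pos_halfPlane_or_three_arcs k with ⟨α, β, hpos⟩ | ⟨α, β, γ, δ, hdet, hk'⟩
  · refine Or.inl (h.isCyclicPolytope_of_halfPlane hι e₀ α β fun i => hpos _ ?_)
    rw [← hk, h.level]
    exact zero_lt_one
  -- In the coordinates `x`, `y` the form `ξ` is `-x y (x + y)`. Being positive at the vertices, it
  -- allows exactly one of `x`, `y`, `-(x + y)` to be positive there, and this tells the arcs apart.
  obtain ⟨M, hM⟩ := exists_planeEquiv hdet
  set e := e₀.trans M with he
  have hf : ∀ i, (e (w i)).1 * (e (w i)).2 * ((e (w i)).1 + (e (w i)).2) = -1 := fun i => by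
    have h1 := h.level i
    rw [hk, hk'] at h1
    simp only [he, LinearEquiv.trans_apply, hM]
    linarith
  set x : ι → ℝ := fun i => (e (w i)).1 with hx
  set y : ι → ℝ := fun i => (e (w i)).2 with hy
  replace hf : ∀ i, x i * y i * (x i + y i) = -1 := hf
  have hd : ∀ i j, planeDet (e (w i)) (e (w j)) = x i * y j - x j * y i := fun i j => rfl
  have hx0 : ∀ i, x i ≠ 0 := fun i h0 => by simpa [h0] using hf i
  have hy0 : ∀ i, y i ≠ 0 := fun i h0 => by simpa [h0] using hf i
  have hz0 : ∀ i, x i + y i ≠ 0 := fun i h0 => by simpa [h0] using hf i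
  have hX : ∀ i, 0 < x i → y i < 0 ∧ 0 < x i + y i := fun i hi => by
    have hyi : y i < 0 := by
      by_contra! hn
      have : 0 ≤ x i * y i * (x i + y i) := by positivity
      linarith [hf i]
    refine ⟨hyi, ?_⟩
    by_contra! hn
    have := mul_nonneg_of_nonpos_of_nonpos (mul_neg_of_pos_of_neg hi hyi).le hn
    linarith [hf i]
  have hY : ∀ i, 0 < y i → x i < 0 ∧ 0 < x i + y i := fun i hi => by
    have hxi : x i < 0 := by
      by_contra! hn
      have : 0 ≤ x i * y i * (x i + y i) := by positivity
      linarith [hf i]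
    refine ⟨hxi, ?_⟩
    by_contra! hn
    have := mul_nonneg_of_nonpos_of_nonpos (mul_neg_of_neg_of_pos hxi hi).le hn
    linarith [hf i]
  have hZ : ∀ i, x i + y i < 0 → x i < 0 ∧ y i < 0 := fun i hi => by
    constructor
    · by_contra! hn
      linarith [(hX i (lt_of_le_of_ne hn (hx0 i).symm)).2]
    · by_contra! hn
      linarith [(hY i (lt_of_le_of_ne hn (hy0 i).symm)).2]
  have h1 : ∀ i ∈ {i | 0 < x i}, ∀ j ∈ {i | 0 < y i}, 0 < planeDet (e (w i)) (e (w j)) := by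
    intro i hi j hj
    have a1 := mul_pos hi (hY j hj).2
    have a2 := mul_pos (neg_pos.2 (hY j hj).1) (hX i hi).2
    rw [hd]
    linarith
  have h2 : ∀ i ∈ {i | 0 < y i}, ∀ j ∈ {i | x i + y i < 0},
      0 < planeDet (e (w i)) (e (w j)) := by
    intro i hi j hj
    have a1 := mul_pos_of_neg_of_neg (hY i hi).1 (hZ j hj).2
    have a2 := mul_pos (neg_pos.2 (hZ j hj).1) hi
    rw [hd]
    linarith
  have h3 : ∀ i ∈ {i | x i + y i < 0}, ∀ j ∈ {i | 0 < x i},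
      0 < planeDet (e (w i)) (e (w j)) := by
    intro i hi j hj
    have a1 := mul_pos_of_neg_of_neg (hZ i hi).1 (hX j hj).1
    have a2 := mul_pos (neg_pos.2 (hZ i hi).2) hj
    rw [hd]
    linarith
  -- If the arc `x > 0` is empty, all vectors satisfy `-x > 0`, a half plane; likewise for the other
  -- two arcs.
  rcases Set.eq_empty_or_nonempty {i | 0 < x i} with hS | hS
  · refine Or.inl (h.isCyclicPolytope_of_halfPlane hι e (-1) 0 fun i => ?_)
    have : ¬ 0 < x i := fun hi => (hS ▸ hi : i ∈ (∅ : Set ι))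
    have := lt_of_le_of_ne (not_lt.1 this) (hx0 i)
    simpa using this
  rcases Set.eq_empty_or_nonempty {i | 0 < y i} with hS' | hS'
  · refine Or.inl (h.isCyclicPolytope_of_halfPlane hι e 0 (-1) fun i => ?_)
    have : ¬ 0 < y i := fun hi => (hS' ▸ hi : i ∈ (∅ : Set ι))
    have := lt_of_le_of_ne (not_lt.1 this) (hy0 i)
    simpa using this
  rcases Set.eq_empty_or_nonempty {i | x i + y i < 0} with hS'' | hS''
  · refine Or.inl (h.isCyclicPolytope_of_halfPlane hι e 1 1 fun i => ?_)
    have : ¬ x i + y i < 0 := fun hi => (hS'' ▸ hi : i ∈ (∅ : Set ι))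
    have := lt_of_le_of_ne (not_lt.1 this) (hz0 i).symm
    simpa using this
  have hne : ∀ i j, i ≠ j → planeDet (e (w i)) (e (w j)) ≠ 0 := fun i j => h.planeDet_ne_zero e
  refine h.cyclic_or_octahedron_of_arcs hι e ?_ h1 h2 h3
    (exists_eq_pair_of_no_triple (r := x) (t := fun i => y i / x i) hS (fun i hi => hi)
      (fun i hi j hj => ?_) hne fun i hi j hj k hk =>
        h.not_three_on_arc e h1 h2 h3 hS' hS'' hi hj hk)
    (exists_eq_pair_of_no_triple (r := y) (t := fun i => -x i / y i) hS' (fun i hi => hi)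
      (fun i hi j hj => ?_) hne fun i hi j hj k hk =>
        h.not_three_on_arc e h2 h3 h1 hS'' hS hi hj hk)
    (exists_eq_pair_of_no_triple (r := fun i => -(x i + y i)) (t := fun i => -x i / (x i + y i))
      hS'' (fun i hi => neg_pos.2 hi)
      (fun i hi j hj => ?_) hne fun i hi j hj k hk =>
        h.not_three_on_arc e h3 h1 h2 hS hS' hi hj hk)
  · intro i
    rcases lt_or_gt_of_ne (hx0 i) with hi | hi
    · rcases lt_or_gt_of_ne (hy0 i) with hi' | hi'
      · exact Or.inr (Or.inr (add_neg hi hi'))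
      · exact Or.inr (Or.inl hi')
    · exact Or.inl hi
  · have := hx0 i
    have := hx0 j
    rw [hd]
    field_simp
  · have := hy0 i
    have := hy0 j
    rw [hd]
    field_simp
    ring
  · have := hz0 i
    have := hz0 j
    rw [hd]
    field_simp
    ring

end Classification

theorem mainTheorem11 {V : Type*} [AddCommGroup V] [Module ℝ V]
    (hV : Module.finrank ℝ V = 2)
    (P : Set (symmetricTensors 3 V)) (hP : IsVeronesePolytope 3 P) (hdim : polytopeDim P = 3) :
    IsCyclicPolytope 3 P ∨ CombinatoriallyEquivalent P (crossPolytope 3) := by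
  have : FiniteDimensional ℝ V := Module.finite_of_finrank_pos (by omega)
  obtain ⟨T, w, ξ, hTf, hPT, hirr, hw, hξ⟩ := hP.exists_vertices hdim
  have := hTf.fintype
  have hp : (fun i => tensorPow 3 (w i)) = ((↑) : T → symmetricTensors 3 V) := funext hw
  have hrange : T = Set.range fun i => tensorPow 3 (w i) := by rw [hp, Subtype.range_coe]
  have h : IsVeroneseConfiguration w ξ := by
    refine ⟨fun i => by rw [hw]; exact hξ _ i.2, by rw [hp]; exact Subtype.val_injective,
      fun i hi => hirr i i.2 ?_⟩
    rw [hp, hw] at hi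
    refine convexHull_mono ?_ hi
    rintro _ ⟨j, hj, rfl⟩
    exact ⟨j.2, fun e => hj (Subtype.ext e)⟩
  -- Nonempty sets of `n + 1` points span dimension at most `n`, so dimension `3` needs four
  -- vertices.
  have hι : 4 ≤ Fintype.card T := by
    rw [polytopeDim, hPT, ← direction_affineSpan, affineSpan_convexHull, direction_affineSpan,
      ← Subtype.range_coe (s := T)] at hdim
    by_contra! hlt
    rcases Nat.eq_zero_or_pos (Fintype.card T) with h0 | h0
    · have := Fintype.card_eq_zero_iff.1 h0
      rw [Set.range_eq_empty, vectorSpan_empty, finrank_bot] at hdim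
      omega
    · have := finrank_vectorSpan_range_le ℝ ((↑) : T → symmetricTensors 3 V)
        (n := Fintype.card T - 1) (show Fintype.card T = _ by omega)
      omega
  let e : V ≃ₗ[ℝ] ℝ × ℝ := LinearEquiv.ofFinrankEq _ _ (by simp [hV])
  rw [hPT, hrange]
  exact h.cyclic_or_octahedron hι e
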